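/- Let $k$ be an algebraically closed field of characteristic zero and let $q \in k$ be a primitive third root of unity. Let $u_q = u_q(\mathfrak{sl}_2)$ be the Hopf algebra over $k$ generated as an algebra by $E, F, K$ with relations $$E^3 = F^3 = 0,\quad K^3 = 1,\quad KE = q^2 EK,\quad KF = q^{-2} FK,\quad EF - FE = \frac{K - K^{2}}{q - q^{-1}},$$ and with comultiplication $$\Delta(E) = E \otimes 1 + K \otimes E,\quad \Delta(F) = F \otimes K^{-1} + 1 \otimes F,\quad \Delta(K) = K \otimes K.$$ For a finite-dimensional Hopf algebra $H$ with antipode $S$ and an integer $n \ge 1$, let $\nu_n(H) = \mathrm{Tr}(S \circ P^{(n-1)} : H \to H)$ be its $n$-th indicator, where $P^{(m)}$ is the $m$-th convolution power of $\mathrm{id}_H$ (that is, $P^{(m)}(h) = h_{(1)} \cdots h_{(m)}$ for $m \ge 1$, and $P^{(0)}(h) = \varepsilon(h) 1$). Let $\phi_H(X) \in k[X]$ be the minimal polynomial of the sequence $\{\nu_n(H)\}_{n \ge 1}$, i.e. the monic generator of the ideal of all $\sum_i c_i X^i \in k[X]$ with $\sum_i c_i \nu_{j+i}(H) = 0$ for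 all $j \ge 1$. Then $$\nu_n(u_q) = n^2 \quad \text{for all } n \ge 1,$$ and consequently $\phi_{u_q}(X) = (X - 1)^3$. -/

import Mathlib

/-! ### Sweedler powers, indicators and the minimal polynomial of the indicator sequence -/

namespace HopfIndicator

open Polynomial

variable (k : Type*) [Field k]

/-- The `m`-th Sweedler power map `h ↦ h₍₁₎ ⋯ h₍ₘ₎`: the `m`-th power of the identity map with
respect to the convolution product on linear endomorphisms. -/
noncomputable def sweedlerPow (H : Type*) [Ring H] [HopfAlgebra k H] (m : ℕ) : H →ₗ[k] H :=
  ((WithConv.toConv (LinearMap.id : H →ₗ[k] H)) ^ m).ofConv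

/-- The `n`-th indicator (for `n ≥ 1`) of a finite-dimensional Hopf algebra: the trace of
`S ∘ P^(n-1)`, where `S` is the antipode and `P^(m)` is the `m`-th Sweedler power map.
(`LinearMap.trace` is `0` on a space without a finite basis, so a nonzero value can only occur in
finite dimension.) -/
noncomputable def indicator (H : Type*) [Ring H] [HopfAlgebra k H] (n : ℕ) : k :=
  LinearMap.trace k H (HopfAlgebra.antipode k ∘ₗ sweedlerPow k H (n - 1))

variable {k}

/-- For `p = ∑ cᵢ Xⁱ`, the element `∑ cᵢ v_{j + i}`. -/
noncomputable def shiftEval (v : ℕ → k) (j : ℕ) (p : k[X]) : k :=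
  p.sum fun i c => c * v (j + i)

theorem shiftEval_add (v : ℕ → k) (j : ℕ) (p r : k[X]) :
    shiftEval v j (p + r) = shiftEval v j p + shiftEval v j r :=
  Polynomial.sum_add_index p r _ (by simp) (by intros; ring)

theorem shiftEval_monomial (v : ℕ → k) (j i : ℕ) (c : k) :
    shiftEval v j (monomial i c) = c * v (j + i) :=
  Polynomial.sum_monomial_index c _ (by simp)

theorem shiftEval_monomial_mul (v : ℕ → k) (j i : ℕ) (c : k) (p : k[X]) :
    shiftEval v j (monomial i c * p) = c * shiftEval v (j + i) p := by
  induction p using Polynomial.induction_on' with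
  | add p r hp hr => rw [mul_add, shiftEval_add, hp, hr, shiftEval_add, mul_add]
  | monomial m d =>
    rw [monomial_mul_monomial, shiftEval_monomial, shiftEval_monomial, mul_assoc, add_assoc]

/-- The ideal of all polynomials `∑ cᵢ Xⁱ` with `∑ cᵢ v_{j + i} = 0` for all `j ≥ 1`, attached to a
sequence `v₁, v₂, …` (the value `v 0` is irrelevant). -/
def recurrenceIdeal (v : ℕ → k) : Ideal k[X] where
  carrier := {p | ∀ j, 1 ≤ j → shiftEval v j p = 0}
  add_mem' {p r} hp hr j hj := by rw [shiftEval_add, hp j hj, hr j hj, add_zero]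
  zero_mem' j _ := by simp [shiftEval]
  smul_mem' r p hp := by
    rw [smul_eq_mul]
    induction r using Polynomial.induction_on' with
    | add r s hr hs =>
      intro j hj
      rw [add_mul, shiftEval_add, hr j hj, hs j hj, add_zero]
    | monomial i c =>
      intro j hj
      rw [shiftEval_monomial_mul, hp (j + i) (by omega), mul_zero]

/-- The minimal polynomial of a sequence `v₁, v₂, …`: the monic generator of `recurrenceIdeal v`
if the sequence is linearly recursive, and `0` otherwise. -/
noncomputable def seqMinpoly (v : ℕ → k) : k[X] :=
  Submodule.IsPrincipal.generator (recurrenceIdeal v) *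
    C (Submodule.IsPrincipal.generator (recurrenceIdeal v)).leadingCoeff⁻¹

variable (k)

/-- The minimal polynomial of the sequence of indicators `ν₁, ν₂, …` of a Hopf algebra. -/
noncomputable def indicatorMinpoly (H : Type*) [Ring H] [HopfAlgebra k H] : k[X] :=
  seqMinpoly (indicator k H)

end HopfIndicator

/-! ### The small quantum group of `sl₂` at a root of unity of odd order -/

namespace SmallQuantum

open scoped TensorProduct

/-! #### The `q`-binomial formula -/

section QBinomial

variable {k : Type*} [Field k]

/-- Gaussian binomial coefficients, by the `q`-Pascal rule. -/
def gaussBinom (z : k) : ℕ → ℕ → k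
  | _, 0 => 1
  | 0, _ + 1 => 0
  | n + 1, j + 1 => gaussBinom z n j + z ^ (j + 1) * gaussBinom z n (j + 1)

theorem gaussBinom_zero_right (z : k) (n : ℕ) : gaussBinom z n 0 = 1 := by
  cases n <;> rfl

theorem gaussBinom_succ_succ (z : k) (n j : ℕ) : gaussBinom z (n + 1) (j + 1) =
    gaussBinom z n j + z ^ (j + 1) * gaussBinom z n (j + 1) := rfl

theorem gaussBinom_of_lt (z : k) (n j : ℕ) (h : n < j) : gaussBinom z n j = 0 := by
  induction n generalizing j with
  | zero => obtain ⟨j, rfl⟩ := Nat.exists_eq_succ_of_ne_zero (by omega : j ≠ 0); rfl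
  | succ n ih =>
    obtain ⟨j, rfl⟩ := Nat.exists_eq_succ_of_ne_zero (by omega : j ≠ 0)
    rw [Nat.succ_eq_add_one, gaussBinom_succ_succ, ih j (by omega), ih (j + 1) (by omega)]
    simp

theorem gaussBinom_mul (z : k) (n j : ℕ) :
    (1 - z ^ (j + 1)) * gaussBinom z (n + 1) (j + 1) = (1 - z ^ (n + 1)) * gaussBinom z n j := by
  induction n generalizing j with
  | zero =>
    rw [gaussBinom_succ_succ]
    cases j with
    | zero => simp [gaussBinom]
    | succ j => simp [gaussBinom]
  | succ n ih =>
    have h1 := ih j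
    rw [gaussBinom_succ_succ z (n + 1) j]
    cases j with
    | zero =>
      simp only [gaussBinom_zero_right] at h1 ⊢
      linear_combination z ^ (0 + 1) * h1
    | succ j =>
      have h2 := ih j
      have h3 := gaussBinom_succ_succ z n j
      have h4 := gaussBinom_succ_succ z n (j + 1)
      linear_combination z ^ (j + 1 + 1) * h1 + z * h2 - z * (1 - z ^ (n + 1)) * h3

theorem add_pow_eq_gaussBinom {A : Type*} [Ring A] [Algebra k A] (z : k) (a b : A)
    (h : b * a = z • (a * b)) (n : ℕ) :
    (a + b) ^ n = ∑ j ∈ Finset.range (n + 1), gaussBinom z n j • (a ^ j * b ^ (n - j)) := by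
  have hb : ∀ j : ℕ, b * a ^ j = z ^ j • (a ^ j * b) := by
    intro j
    induction j with
    | zero => simp
    | succ j ih =>
      rw [pow_succ a, ← mul_assoc, ih, smul_mul_assoc, mul_assoc, h, mul_smul_comm, smul_smul,
        pow_succ, mul_assoc]
  induction n with
  | zero => simp [gaussBinom]
  | succ n ih =>
    rw [pow_succ', ih, add_mul, Finset.mul_sum, Finset.mul_sum]
    have e1 : ∀ j ∈ Finset.range (n + 1), b * (gaussBinom z n j • (a ^ j * b ^ (n - j))) =
        (z ^ j * gaussBinom z n j) • (a ^ j * b ^ (n + 1 - j)) := by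
      intro j hj
      have hj' : n + 1 - j = (n - j) + 1 := by
        have := Finset.mem_range.1 hj
        omega
      rw [mul_smul_comm, ← mul_assoc, hb, smul_mul_assoc, smul_smul, mul_assoc, ← pow_succ', hj',
        mul_comm (z ^ j)]
    have e2 : ∀ j ∈ Finset.range (n + 1), a * (gaussBinom z n j • (a ^ j * b ^ (n - j))) =
        gaussBinom z n j • (a ^ (j + 1) * b ^ (n + 1 - (j + 1))) := by
      intro j _
      rw [mul_smul_comm, ← mul_assoc, ← pow_succ', Nat.add_sub_add_right]
    rw [Finset.sum_congr rfl e1, Finset.sum_congr rfl e2]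
    have e3 : ∑ j ∈ Finset.range (n + 1), (z ^ j * gaussBinom z n j) • (a ^ j * b ^ (n + 1 - j)) =
        ∑ j ∈ Finset.range (n + 2), (z ^ j * gaussBinom z n j) • (a ^ j * b ^ (n + 1 - j)) := by
      rw [Finset.sum_range_succ _ (n + 1), gaussBinom_of_lt z n (n + 1) (by omega)]
      simp
    rw [e3, Finset.sum_range_succ' _ (n + 1), Finset.sum_range_succ' _ (n + 1), ← add_assoc,
      ← Finset.sum_add_distrib]
    congr 1
    · refine Finset.sum_congr rfl fun j _ => ?_
      rw [← add_smul, gaussBinom_succ_succ]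
    · simp [gaussBinom_zero_right]

theorem add_pow_eq_zero {A : Type*} [Ring A] [Algebra k A] {z : k} {N : ℕ}
    (hz : IsPrimitiveRoot z N) (hN : 0 < N) {a b : A} (h : b * a = z • (a * b))
    (ha : a ^ N = 0) (hb : b ^ N = 0) : (a + b) ^ N = 0 := by
  rw [add_pow_eq_gaussBinom z a b h]
  refine Finset.sum_eq_zero fun j hj => ?_
  have hj' := Finset.mem_range.1 hj
  rcases Nat.eq_zero_or_pos j with rfl | hj0
  · simp [hb]
  rcases Nat.eq_or_lt_of_le (Nat.lt_succ_iff.1 hj') with rfl | hlt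
  · simp [ha]
  obtain ⟨j, rfl⟩ := Nat.exists_eq_succ_of_ne_zero hj0.ne'
  obtain ⟨N, rfl⟩ := Nat.exists_eq_succ_of_ne_zero hN.ne'
  have h1 := gaussBinom_mul z N j
  rw [show z ^ (N + 1) = 1 from hz.pow_eq_one, sub_self, zero_mul] at h1
  have h2 : (1 : k) - z ^ (j + 1) ≠ 0 := fun h0 =>
    hz.pow_ne_one_of_pos_of_lt hj0.ne' hlt (sub_eq_zero.1 h0).symm
  rw [Nat.succ_eq_add_one, Nat.succ_eq_add_one, (mul_eq_zero.1 h1).resolve_left h2, zero_smul]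

end QBinomial

/-! #### The algebra -/

/-- The names of the three generators. -/
inductive Gen : Type
  | E
  | F
  | K

/-- The defining relations `E^N = F^N = 0`, `K^N = 1`, `KE = q²EK`, `KF = q⁻²FK` and
`EF - FE = (K - K^(N-1)) / (q - q⁻¹)`. -/
inductive Rel {k : Type*} [Field k] (q : k) (N : ℕ) :
    FreeAlgebra k Gen → FreeAlgebra k Gen → Prop
  | E_pow : Rel q N (FreeAlgebra.ι k Gen.E ^ N) 0
  | F_pow : Rel q N (FreeAlgebra.ι k Gen.F ^ N) 0
  | K_pow : Rel q N (FreeAlgebra.ι k Gen.K ^ N) 1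
  | K_mul_E : Rel q N (FreeAlgebra.ι k Gen.K * FreeAlgebra.ι k Gen.E)
      (q ^ 2 • (FreeAlgebra.ι k Gen.E * FreeAlgebra.ι k Gen.K))
  | K_mul_F : Rel q N (FreeAlgebra.ι k Gen.K * FreeAlgebra.ι k Gen.F)
      ((q ^ 2)⁻¹ • (FreeAlgebra.ι k Gen.F * FreeAlgebra.ι k Gen.K))
  | E_F : Rel q N
      (FreeAlgebra.ι k Gen.E * FreeAlgebra.ι k Gen.F -
        FreeAlgebra.ι k Gen.F * FreeAlgebra.ι k Gen.E)
      ((q - q⁻¹)⁻¹ • (FreeAlgebra.ι k Gen.K - FreeAlgebra.ι k Gen.K ^ (N - 1)))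

end SmallQuantum

/-- The small quantum group `u_q(sl₂)` (as an algebra), where `q` is a root of unity of odd
order `N`: the algebra generated by `E`, `F`, `K` subject to `SmallQuantum.Rel`. Its Hopf algebra
structure is `SmallQuantumSL2.instHopfAlgebra`. -/
def SmallQuantumSL2 {k : Type*} [Field k] (q : k) (N : ℕ) : Type _ :=
  RingQuot (SmallQuantum.Rel q N)

namespace SmallQuantumSL2

open SmallQuantum
open scoped TensorProduct

variable {k : Type*} [Field k] (q : k) (N : ℕ)

noncomputable instance : Ring (SmallQuantumSL2 q N) :=
  inferInstanceAs (Ring (RingQuot (Rel q N)))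

noncomputable instance instAlgebra : Algebra k (SmallQuantumSL2 q N) :=
  inferInstanceAs (Algebra k (RingQuot (Rel q N)))

/-- The projection from the free algebra. -/
noncomputable def proj : FreeAlgebra k Gen →ₐ[k] SmallQuantumSL2 q N :=
  RingQuot.mkAlgHom k (Rel q N)

theorem proj_surjective : Function.Surjective (proj q N) :=
  RingQuot.mkAlgHom_surjective k (Rel q N)

theorem proj_rel {x y : FreeAlgebra k Gen} (h : Rel q N x y) : proj q N x = proj q N y :=
  RingQuot.mkAlgHom_rel k h

/-- The generator `E`. -/
noncomputable def E : SmallQuantumSL2 q N := proj q N (FreeAlgebra.ι k Gen.E)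

/-- The generator `F`. -/
noncomputable def F : SmallQuantumSL2 q N := proj q N (FreeAlgebra.ι k Gen.F)

/-- The generator `K`. -/
noncomputable def K : SmallQuantumSL2 q N := proj q N (FreeAlgebra.ι k Gen.K)

theorem E_pow : E q N ^ N = 0 := by
  simpa [E] using proj_rel q N Rel.E_pow

theorem F_pow : F q N ^ N = 0 := by
  simpa [F] using proj_rel q N Rel.F_pow

theorem K_pow : K q N ^ N = 1 := by
  simpa [K] using proj_rel q N Rel.K_pow

theorem K_mul_E : K q N * E q N = q ^ 2 • (E q N * K q N) := by
  simpa [K, E] using proj_rel q N Rel.K_mul_E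

theorem K_mul_F : K q N * F q N = (q ^ 2)⁻¹ • (F q N * K q N) := by
  simpa [K, F] using proj_rel q N Rel.K_mul_F

theorem E_F : E q N * F q N - F q N * E q N = (q - q⁻¹)⁻¹ • (K q N - K q N ^ (N - 1)) := by
  simpa [K, E, F] using proj_rel q N Rel.E_F

variable {q N}

/-- The elements `e`, `f`, `κ` of an algebra satisfy the defining relations of `u_q(sl₂)`. -/
structure IsTriple (q : k) (N : ℕ) {B : Type*} [Ring B] [Algebra k B] (e f κ : B) : Prop where
  e_pow : e ^ N = 0
  f_pow : f ^ N = 0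
  κ_pow : κ ^ N = 1
  κ_e : κ * e = q ^ 2 • (e * κ)
  κ_f : κ * f = (q ^ 2)⁻¹ • (f * κ)
  e_f : e * f - f * e = (q - q⁻¹)⁻¹ • (κ - κ ^ (N - 1))

/-- The images of the generators. -/
def genMap {B : Type*} (e f κ : B) : Gen → B
  | .E => e
  | .F => f
  | .K => κ

/-- The algebra map out of `u_q(sl₂)` given by the images of the generators. -/
noncomputable def lift {B : Type*} [Ring B] [Algebra k B] (e f κ : B) (h : IsTriple q N e f κ) :
    SmallQuantumSL2 q N →ₐ[k] B :=
  RingQuot.liftAlgHom k ⟨FreeAlgebra.lift k (genMap e f κ), by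
    intro x y hxy
    cases hxy with
    | E_pow => simpa [genMap] using h.e_pow
    | F_pow => simpa [genMap] using h.f_pow
    | K_pow => simpa [genMap] using h.κ_pow
    | K_mul_E => simpa [genMap] using h.κ_e
    | K_mul_F => simpa [genMap] using h.κ_f
    | E_F => simpa [genMap] using h.e_f⟩

section lift

variable {B : Type*} [Ring B] [Algebra k B] (e f κ : B) (h : IsTriple q N e f κ)

theorem lift_proj (x : FreeAlgebra k Gen) :
    lift e f κ h (proj q N x) = FreeAlgebra.lift k (genMap e f κ) x :=
  RingQuot.liftAlgHom_mkAlgHom_apply k _ _ x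

theorem lift_E : lift e f κ h (E q N) = e := by
  rw [E, lift_proj, FreeAlgebra.lift_ι_apply]; rfl

theorem lift_F : lift e f κ h (F q N) = f := by
  rw [F, lift_proj, FreeAlgebra.lift_ι_apply]; rfl

theorem lift_K : lift e f κ h (K q N) = κ := by
  rw [K, lift_proj, FreeAlgebra.lift_ι_apply]; rfl

end lift

theorem algHom_ext {B : Type*} [Semiring B] [Algebra k B] {φ ψ : SmallQuantumSL2 q N →ₐ[k] B}
    (hE : φ (E q N) = ψ (E q N)) (hF : φ (F q N) = ψ (F q N)) (hK : φ (K q N) = ψ (K q N)) :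
    φ = ψ := by
  have h : φ.comp (proj q N) = ψ.comp (proj q N) := by
    ext g
    cases g
    · exact hE
    · exact hF
    · exact hK
  ext x
  obtain ⟨y, rfl⟩ := proj_surjective q N x
  exact DFunLike.congr_fun h y

theorem gen_induction {P : SmallQuantumSL2 q N → Prop} (hE : P (E q N)) (hF : P (F q N))
    (hK : P (K q N)) (hs : ∀ c : k, P (algebraMap k _ c)) (ha : ∀ x y, P x → P y → P (x + y))
    (hm : ∀ x y, P x → P y → P (x * y)) (x : SmallQuantumSL2 q N) : P x := by
  obtain ⟨y, rfl⟩ := proj_surjective q N x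
  induction y using FreeAlgebra.induction with
  | grade0 c => rw [AlgHom.commutes]; exact hs c
  | grade1 g =>
    cases g
    · exact hE
    · exact hF
    · exact hK
  | mul a b h1 h2 => rw [map_mul]; exact hm _ _ h1 h2
  | add a b h1 h2 => rw [map_add]; exact ha _ _ h1 h2

/-! #### The Hopf algebra structure -/

variable (q N)

/-- The inverse `K⁻¹ = K^(N-1)` of `K`. -/
noncomputable def Kinv : SmallQuantumSL2 q N := K q N ^ (N - 1)

theorem K_mul_Kinv (hN : Odd N) : K q N * Kinv q N = 1 := by
  rw [Kinv, ← pow_succ', Nat.sub_add_cancel hN.pos, K_pow]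

theorem Kinv_mul_K (hN : Odd N) : Kinv q N * K q N = 1 := by
  rw [Kinv, ← pow_succ, Nat.sub_add_cancel hN.pos, K_pow]

theorem Kinv_pow : Kinv q N ^ N = 1 := by
  rw [Kinv, ← pow_mul, mul_comm, pow_mul, K_pow, one_pow]

theorem Kinv_pow_pred (hN : Odd N) : Kinv q N ^ (N - 1) = K q N := by
  have h : Kinv q N ^ (N - 1) * (Kinv q N * K q N) = K q N := by
    rw [← mul_assoc, ← pow_succ, Nat.sub_add_cancel hN.pos, Kinv_pow, one_mul]
  rwa [Kinv_mul_K q N hN, mul_one] at h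

theorem E_mul_Kinv (hN : Odd N) : E q N * Kinv q N = q ^ 2 • (Kinv q N * E q N) := by
  have h : Kinv q N * (K q N * E q N) * Kinv q N =
      q ^ 2 • (Kinv q N * E q N * (K q N * Kinv q N)) := by
    rw [K_mul_E, mul_smul_comm, smul_mul_assoc, mul_assoc, mul_assoc, mul_assoc]
  rwa [← mul_assoc, Kinv_mul_K q N hN, one_mul, K_mul_Kinv q N hN, mul_one] at h

theorem F_mul_Kinv (hN : Odd N) : F q N * Kinv q N = (q ^ 2)⁻¹ • (Kinv q N * F q N) := by
  have h : Kinv q N * (K q N * F q N) * Kinv q N =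
      (q ^ 2)⁻¹ • (Kinv q N * F q N * (K q N * Kinv q N)) := by
    rw [K_mul_F, mul_smul_comm, smul_mul_assoc, mul_assoc, mul_assoc, mul_assoc]
  rwa [← mul_assoc, Kinv_mul_K q N hN, one_mul, K_mul_Kinv q N hN, mul_one] at h

theorem mul_pow_eq_smul {A : Type*} [Ring A] [Algebra k A] {z : k} {a b : A}
    (h : b * a = z • (a * b)) (n : ℕ) : ∃ c : k, (a * b) ^ n = c • (a ^ n * b ^ n) := by
  have hb : ∀ j : ℕ, b ^ j * a = z ^ j • (a * b ^ j) := by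
    intro j
    induction j with
    | zero => simp
    | succ j ih =>
      rw [pow_succ b, mul_assoc, h, mul_smul_comm, ← mul_assoc, ih, smul_mul_assoc, smul_smul,
        mul_assoc, pow_succ' z]
  induction n with
  | zero => exact ⟨1, by simp⟩
  | succ n ih =>
    obtain ⟨c, hc⟩ := ih
    refine ⟨c * z ^ n, ?_⟩
    rw [pow_succ, hc, smul_mul_assoc, mul_assoc, ← mul_assoc (b ^ n), hb, smul_mul_assoc,
      mul_smul_comm, smul_smul, mul_assoc, ← pow_succ, ← mul_assoc, ← pow_succ]

theorem isPrimitiveRoot_sq {q : k} {N : ℕ} (hN : Odd N) (hq : IsPrimitiveRoot q N) :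
    IsPrimitiveRoot (q ^ 2) N :=
  hq.pow_of_coprime 2 hN.coprime_two_left

theorem isTriple_comul (hN : Odd N) (hq : IsPrimitiveRoot q N) :
    IsTriple q N (E q N ⊗ₜ[k] (1 : SmallQuantumSL2 q N) + K q N ⊗ₜ[k] E q N)
      (F q N ⊗ₜ[k] Kinv q N + (1 : SmallQuantumSL2 q N) ⊗ₜ[k] F q N)
      (K q N ⊗ₜ[k] K q N) := by
  have hq2 : q ^ 2 ≠ 0 := pow_ne_zero 2 (hq.ne_zero hN.pos.ne')
  have hz := isPrimitiveRoot_sq hN hq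
  have hκ : (K q N ⊗ₜ[k] K q N) ^ (N - 1) = Kinv q N ⊗ₜ[k] Kinv q N :=
    Algebra.TensorProduct.tmul_pow _ _ _
  constructor
  · refine add_pow_eq_zero hz hN.pos ?_ ?_ ?_
    · simp only [Algebra.TensorProduct.tmul_mul_tmul, K_mul_E, one_mul, mul_one,
        TensorProduct.smul_tmul']
    · rw [Algebra.TensorProduct.tmul_pow, E_pow, TensorProduct.zero_tmul]
    · rw [Algebra.TensorProduct.tmul_pow, E_pow, TensorProduct.tmul_zero]
  · refine add_pow_eq_zero hz.inv hN.pos ?_ ?_ ?_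
    · simp only [Algebra.TensorProduct.tmul_mul_tmul, F_mul_Kinv q N hN, one_mul, mul_one,
        TensorProduct.tmul_smul]
    · rw [Algebra.TensorProduct.tmul_pow, F_pow, TensorProduct.zero_tmul]
    · rw [Algebra.TensorProduct.tmul_pow, F_pow, TensorProduct.tmul_zero]
  · rw [Algebra.TensorProduct.tmul_pow, K_pow]; rfl
  · simp only [mul_add, add_mul, Algebra.TensorProduct.tmul_mul_tmul, K_mul_E, one_mul, mul_one,
      TensorProduct.smul_tmul', TensorProduct.tmul_smul, smul_add]
  · simp only [mul_add, add_mul, Algebra.TensorProduct.tmul_mul_tmul, K_mul_F, one_mul, mul_one,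
      TensorProduct.smul_tmul', TensorProduct.tmul_smul, smul_add, K_mul_Kinv q N hN,
      Kinv_mul_K q N hN]
  · have h1 : E q N * F q N = F q N * E q N + (q - q⁻¹)⁻¹ • (K q N - Kinv q N) := by
      rw [Kinv, ← E_F]; abel
    rw [hκ]
    simp only [mul_add, add_mul, Algebra.TensorProduct.tmul_mul_tmul, one_mul, mul_one, K_mul_F,
      E_mul_Kinv q N hN, h1, TensorProduct.tmul_add, TensorProduct.add_tmul,
      TensorProduct.tmul_smul, ← TensorProduct.smul_tmul', smul_smul, mul_inv_cancel₀ hq2,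
      one_smul, TensorProduct.tmul_sub, TensorProduct.sub_tmul, smul_sub]
    abel

/-- The comultiplication: `Δ(E) = E ⊗ 1 + K ⊗ E`, `Δ(F) = F ⊗ K⁻¹ + 1 ⊗ F`, `Δ(K) = K ⊗ K`. -/
noncomputable def comulHom (hN : Odd N) (hq : IsPrimitiveRoot q N) :
    SmallQuantumSL2 q N →ₐ[k] SmallQuantumSL2 q N ⊗[k] SmallQuantumSL2 q N :=
  lift _ _ _ (isTriple_comul q N hN hq)

theorem isTriple_counit (hN : Odd N) : IsTriple q N (0 : k) 0 1 := by
  constructor <;> simp [hN.pos.ne']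

/-- The counit: `ε(E) = ε(F) = 0`, `ε(K) = 1`. -/
noncomputable def counitHom (hN : Odd N) : SmallQuantumSL2 q N →ₐ[k] k :=
  lift _ _ _ (isTriple_counit q N hN)

open MulOpposite in
theorem isTriple_antipode (hN : Odd N) (hq : IsPrimitiveRoot q N) :
    IsTriple q N (op (-(Kinv q N * E q N))) (op (-(F q N * K q N))) (op (Kinv q N)) := by
  have hq2 : q ^ 2 ≠ 0 := pow_ne_zero 2 (hq.ne_zero hN.pos.ne')
  constructor
  · obtain ⟨c, hc⟩ := mul_pow_eq_smul (E_mul_Kinv q N hN) N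
    rw [← op_pow, neg_pow, hc, E_pow]; simp
  · obtain ⟨c, hc⟩ := mul_pow_eq_smul (K_mul_F q N) N
    rw [← op_pow, neg_pow, hc, F_pow]; simp
  · rw [← op_pow, Kinv_pow, op_one]
  · rw [← op_mul, ← op_mul, ← op_smul, neg_mul, mul_neg, mul_assoc, E_mul_Kinv q N hN,
      mul_smul_comm, smul_neg]
  · rw [← op_mul, ← op_mul, ← op_smul, neg_mul, mul_neg, mul_assoc, K_mul_Kinv q N hN, mul_one,
      ← mul_assoc, smul_neg, ← smul_mul_assoc, ← F_mul_Kinv q N hN, mul_assoc,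
      Kinv_mul_K q N hN, mul_one]
  · have h1 : F q N * K q N * (Kinv q N * E q N) = F q N * E q N := by
      rw [mul_assoc, ← mul_assoc (K q N), K_mul_Kinv q N hN, one_mul]
    have h2 : Kinv q N * E q N * (F q N * K q N) = E q N * F q N := by
      have h3 : E q N * (F q N * Kinv q N) = Kinv q N * (E q N * F q N) := by
        rw [F_mul_Kinv q N hN, mul_smul_comm, ← mul_assoc, E_mul_Kinv q N hN, smul_mul_assoc,
          smul_smul, inv_mul_cancel₀ hq2, one_smul, mul_assoc]
      rw [mul_assoc, ← mul_assoc (E q N), ← mul_assoc, ← h3, mul_assoc, mul_assoc,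
        Kinv_mul_K q N hN, mul_one]
    rw [← op_mul, ← op_mul, ← op_pow, Kinv_pow_pred q N hN, neg_mul_neg, neg_mul_neg, h1, h2,
      ← op_sub, ← op_sub, ← op_smul, ← neg_sub (E q N * F q N), E_F, ← smul_neg, neg_sub]
    rfl

/-- The antipode as an algebra map to the opposite algebra:
`S(E) = -K⁻¹E`, `S(F) = -FK`, `S(K) = K⁻¹`. -/
noncomputable def antipodeHom (hN : Odd N) (hq : IsPrimitiveRoot q N) :
    SmallQuantumSL2 q N →ₐ[k] (SmallQuantumSL2 q N)ᵐᵒᵖ :=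
  lift _ _ _ (isTriple_antipode q N hN hq)

/-- The antipode as a linear map. -/
noncomputable def antipodeLin (hN : Odd N) (hq : IsPrimitiveRoot q N) :
    SmallQuantumSL2 q N →ₗ[k] SmallQuantumSL2 q N :=
  (MulOpposite.opLinearEquiv k).symm.toLinearMap ∘ₗ (antipodeHom q N hN hq).toLinearMap

section

variable (hN : Odd N) (hq : IsPrimitiveRoot q N)

theorem comulHom_E : comulHom q N hN hq (E q N) = E q N ⊗ₜ[k] 1 + K q N ⊗ₜ[k] E q N :=
  lift_E _ _ _ _

theorem comulHom_F : comulHom q N hN hq (F q N) = F q N ⊗ₜ[k] Kinv q N + 1 ⊗ₜ[k] F q N :=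
  lift_F _ _ _ _

theorem comulHom_K : comulHom q N hN hq (K q N) = K q N ⊗ₜ[k] K q N := lift_K _ _ _ _

theorem comulHom_Kinv : comulHom q N hN hq (Kinv q N) = Kinv q N ⊗ₜ[k] Kinv q N := by
  rw [Kinv, map_pow, comulHom_K, Algebra.TensorProduct.tmul_pow]

theorem counitHom_E : counitHom q N hN (E q N) = 0 := lift_E _ _ _ _

theorem counitHom_F : counitHom q N hN (F q N) = 0 := lift_F _ _ _ _

theorem counitHom_K : counitHom q N hN (K q N) = 1 := lift_K _ _ _ _

theorem counitHom_Kinv : counitHom q N hN (Kinv q N) = 1 := by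
  rw [Kinv, map_pow, counitHom_K, one_pow]

theorem antipodeLin_E : antipodeLin q N hN hq (E q N) = -(Kinv q N * E q N) :=
  congrArg MulOpposite.unop (lift_E _ _ _ (isTriple_antipode q N hN hq))

theorem antipodeLin_F : antipodeLin q N hN hq (F q N) = -(F q N * K q N) :=
  congrArg MulOpposite.unop (lift_F _ _ _ (isTriple_antipode q N hN hq))

theorem antipodeLin_K : antipodeLin q N hN hq (K q N) = Kinv q N :=
  congrArg MulOpposite.unop (lift_K _ _ _ (isTriple_antipode q N hN hq))

theorem antipodeLin_one : antipodeLin q N hN hq 1 = 1 :=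
  congrArg MulOpposite.unop (map_one (antipodeHom q N hN hq))

theorem antipodeLin_mul (x y : SmallQuantumSL2 q N) :
    antipodeLin q N hN hq (x * y) = antipodeLin q N hN hq y * antipodeLin q N hN hq x :=
  congrArg MulOpposite.unop (map_mul (antipodeHom q N hN hq) x y)

theorem antipodeLin_algebraMap (c : k) :
    antipodeLin q N hN hq (algebraMap k _ c) = algebraMap k _ c := by
  rw [Algebra.algebraMap_eq_smul_one, map_smul, antipodeLin_one]

theorem antipodeLin_Kinv : antipodeLin q N hN hq (Kinv q N) = K q N := by
  have h : antipodeLin q N hN hq (Kinv q N * K q N) = 1 := by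
    rw [Kinv_mul_K q N hN, antipodeLin_one]
  rw [antipodeLin_mul, antipodeLin_K] at h
  calc antipodeLin q N hN hq (Kinv q N)
      = K q N * Kinv q N * antipodeLin q N hN hq (Kinv q N) := by rw [K_mul_Kinv q N hN, one_mul]
    _ = K q N := by rw [mul_assoc, h, mul_one]

/-- The bialgebra structure. -/
noncomputable abbrev bialgebraOf : Bialgebra k (SmallQuantumSL2 q N) :=
  Bialgebra.ofAlgHom (comulHom q N hN hq) (counitHom q N hN)
    (by
      apply algHom_ext
      · simp [comulHom_E, comulHom_K, TensorProduct.add_tmul, TensorProduct.tmul_add,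
          Algebra.TensorProduct.one_def, add_assoc]
      · simp [comulHom_F, comulHom_Kinv, TensorProduct.add_tmul, TensorProduct.tmul_add,
          Algebra.TensorProduct.one_def, add_assoc]
      · simp [comulHom_K])
    (by
      apply algHom_ext
      · simp [comulHom_E, counitHom_E, counitHom_K]
      · simp [comulHom_F, counitHom_F]
      · simp [comulHom_K, counitHom_K])
    (by
      apply algHom_ext
      · simp [comulHom_E, counitHom_E]
      · simp [comulHom_F, counitHom_F, counitHom_Kinv]
      · simp [comulHom_K, counitHom_K])

/-- `x ⊗ y ↦ S(x) y`. -/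
noncomputable def antipodeLeft :
    SmallQuantumSL2 q N ⊗[k] SmallQuantumSL2 q N →ₗ[k] SmallQuantumSL2 q N :=
  LinearMap.mul' k _ ∘ₗ (antipodeLin q N hN hq).rTensor _

/-- `x ⊗ y ↦ x S(y)`. -/
noncomputable def antipodeRight :
    SmallQuantumSL2 q N ⊗[k] SmallQuantumSL2 q N →ₗ[k] SmallQuantumSL2 q N :=
  LinearMap.mul' k _ ∘ₗ (antipodeLin q N hN hq).lTensor _

theorem antipodeLeft_tmul (x y : SmallQuantumSL2 q N) :
    antipodeLeft q N hN hq (x ⊗ₜ y) = antipodeLin q N hN hq x * y := by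
  simp [antipodeLeft]

theorem antipodeRight_tmul (x y : SmallQuantumSL2 q N) :
    antipodeRight q N hN hq (x ⊗ₜ y) = x * antipodeLin q N hN hq y := by
  simp [antipodeRight]

theorem antipodeLeft_mul (s t : SmallQuantumSL2 q N ⊗[k] SmallQuantumSL2 q N) (c : k)
    (h : antipodeLeft q N hN hq s = algebraMap k _ c) :
    antipodeLeft q N hN hq (s * t) = c • antipodeLeft q N hN hq t := by
  induction t using TensorProduct.induction_on with
  | zero => simp
  | add t u ht hu => rw [mul_add, map_add, ht, hu, map_add, smul_add]
  | tmul a b =>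
    have h1 : antipodeLeft q N hN hq (s * a ⊗ₜ b) =
        antipodeLin q N hN hq a * antipodeLeft q N hN hq s * b := by
      clear h
      induction s using TensorProduct.induction_on with
      | zero => simp
      | add t u ht hu => rw [add_mul, map_add, ht, hu, map_add, mul_add, add_mul]
      | tmul x y =>
        simp only [Algebra.TensorProduct.tmul_mul_tmul, antipodeLeft_tmul, antipodeLin_mul,
          mul_assoc]
    rw [h1, h, antipodeLeft_tmul, ← Algebra.commutes, mul_assoc, Algebra.smul_def]

theorem antipodeRight_mul (s t : SmallQuantumSL2 q N ⊗[k] SmallQuantumSL2 q N) (c : k)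
    (h : antipodeRight q N hN hq t = algebraMap k _ c) :
    antipodeRight q N hN hq (s * t) = c • antipodeRight q N hN hq s := by
  induction s using TensorProduct.induction_on with
  | zero => simp
  | add t u ht hu => rw [add_mul, map_add, ht, hu, map_add, smul_add]
  | tmul a b =>
    have h1 : antipodeRight q N hN hq (a ⊗ₜ b * t) =
        a * antipodeRight q N hN hq t * antipodeLin q N hN hq b := by
      clear h
      induction t using TensorProduct.induction_on with
      | zero => simp
      | add t u ht hu => rw [mul_add, map_add, ht, hu, map_add, mul_add, add_mul]
      | tmul x y =>
        simp only [Algebra.TensorProduct.tmul_mul_tmul, antipodeRight_tmul, antipodeLin_mul,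
          mul_assoc]
    rw [h1, h, antipodeRight_tmul, ← Algebra.commutes, mul_assoc, Algebra.smul_def]

theorem antipodeLeft_comul (x : SmallQuantumSL2 q N) :
    antipodeLeft q N hN hq (comulHom q N hN hq x) = algebraMap k _ (counitHom q N hN x) := by
  induction x using gen_induction with
  | hE => simp [comulHom_E, counitHom_E, antipodeLeft_tmul, antipodeLin_E, antipodeLin_K]
  | hF =>
    simp [comulHom_F, counitHom_F, antipodeLeft_tmul, antipodeLin_F, antipodeLin_one, mul_assoc,
      K_mul_Kinv q N hN]
  | hK => simp [comulHom_K, counitHom_K, antipodeLeft_tmul, antipodeLin_K, Kinv_mul_K q N hN]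
  | hs c =>
    rw [AlgHom.commutes, AlgHom.commutes, Algebra.TensorProduct.algebraMap_apply,
      antipodeLeft_tmul, antipodeLin_algebraMap, mul_one]; rfl
  | ha x y hx hy => rw [map_add, map_add, hx, hy, map_add, map_add]
  | hm x y hx hy =>
    rw [map_mul, antipodeLeft_mul q N hN hq _ _ _ hx, hy, map_mul, map_mul, Algebra.smul_def]

theorem antipodeRight_comul (x : SmallQuantumSL2 q N) :
    antipodeRight q N hN hq (comulHom q N hN hq x) = algebraMap k _ (counitHom q N hN x) := by
  induction x using gen_induction with
  | hE =>
    simp [comulHom_E, counitHom_E, antipodeRight_tmul, antipodeLin_E, antipodeLin_one,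
      ← mul_assoc, K_mul_Kinv q N hN]
  | hF =>
    simp [comulHom_F, counitHom_F, antipodeRight_tmul, antipodeLin_F, antipodeLin_Kinv]
  | hK => simp [comulHom_K, counitHom_K, antipodeRight_tmul, antipodeLin_K, K_mul_Kinv q N hN]
  | hs c =>
    rw [AlgHom.commutes, AlgHom.commutes, Algebra.TensorProduct.algebraMap_apply,
      antipodeRight_tmul, antipodeLin_one, mul_one]; rfl
  | ha x y hx hy => rw [map_add, map_add, hx, hy, map_add, map_add]
  | hm x y hx hy =>
    rw [map_mul, antipodeRight_mul q N hN hq _ _ _ hy, hx, map_mul, map_mul, Algebra.smul_def,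
      Algebra.commutes]

end

/-- The Hopf algebra `u_q(sl₂)`, for `q` a root of unity of odd order `N`. -/
noncomputable instance instHopfAlgebra [hN : Fact (Odd N)] [hq : Fact (IsPrimitiveRoot q N)] :
    HopfAlgebra k (SmallQuantumSL2 q N) where
  toBialgebra := bialgebraOf q N hN.out hq.out
  antipode := antipodeLin q N hN.out hq.out
  mul_antipode_rTensor_comul := LinearMap.ext (antipodeLeft_comul q N hN.out hq.out)
  mul_antipode_lTensor_comul := LinearMap.ext (antipodeRight_comul q N hN.out hq.out)

instance : Fact (Odd 3) := ⟨by decide⟩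

end SmallQuantumSL2

/-! Replace `F` by `FK = F * K`. Then `E` and `FK` are skew primitive in the same way, Δ(x) = x ⊗ 1
+ K ⊗ x, and `K` commutes with them up to q² and q⁻² respectively. The monomials E^a (FK)^b K^c with
a, b, c < 3 form a basis (`monoBasis`), and the span of the monomials with a + b < d defines a
filtration (`degLT`). Since FK·E − q²·E·FK is a combination of 1 and K², the two generators commute
up to a scalar and terms of lower degree.

Both S and the Sweedler powers respect this filtration, so the trace of S ∘ P^(m) is read off from
leading terms. Modulo lower degree, P^(m)(E^a (FK)^b K^c) is E^a (FK)^b times an element of the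
group algebra of ⟨K⟩, and this element is a power of K times a factor depending only on (m, a, c)
and a factor depending only on (m, b, c) (`sweedlerPow_mono_sub_mem`). Both factors are values of
one recursion, `skewPow`, with parameters q² and q⁻². The antipode contributes signs, powers of q
and an inversion of K (`coordMono_antipode`). Summing over a and b therefore gives, for each c, one
coefficient of a product of two elements of a commutative ring (`indicator_succ`).

The alternating sum in each factor is one further step of the same recursion: it equals `skewPow` at
m + 1 = n and a = 2 (`skewTrace_eq`). Because K³ = 1, that recursion grows linearly along each
residue class of n modulo 3. In each class the indicator becomes an explicit expression in t = ⌊n/3⌋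
and q, which collapses to n² modulo 1 + q + q² = 0 (`indicator_eq`).

For the minimal polynomial, multiplication by X − 1 is the difference operator: the third difference
of n² vanishes and the second is 2 ≠ 0 (`seqMinpoly_sq`). -/

namespace SmallQuantumSL2

open SmallQuantum
open scoped TensorProduct

/-! ### Commutation rules for `E`, `FK` and `K`. -/

section Commutation

variable {k : Type*} [Field k]

theorem pow_mul_pow_of_mul_eq_smul {A : Type*} [Ring A] [Algebra k A] {z : k} {x y : A}
    (h : x * y = z • (y * x)) (m n : ℕ) : x ^ m * y ^ n = z ^ (m * n) • (y ^ n * x ^ m) := by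
  have h1 : ∀ n : ℕ, x * y ^ n = z ^ n • (y ^ n * x) := by
    intro n
    induction n with
    | zero => simp
    | succ n ih =>
      rw [pow_succ y, ← mul_assoc, ih, smul_mul_assoc, mul_assoc, h, mul_smul_comm, smul_smul,
        ← pow_succ, mul_assoc]
  induction m with
  | zero => simp
  | succ m ih =>
    rw [pow_succ x, mul_assoc, h1, mul_smul_comm, ← mul_assoc, ih, smul_mul_assoc, smul_smul,
      mul_assoc, ← pow_add]
    congr 2
    ring

variable (q : k)

/-- The element `F * K`, which is skew primitive in the same way as `E`. -/
noncomputable def FK : SmallQuantumSL2 q 3 := F q 3 * K q 3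

/-- The monomial `E ^ a * (F * K) ^ b * K ^ c`. -/
noncomputable def mono (a b c : ℕ) : SmallQuantumSL2 q 3 := E q 3 ^ a * FK q ^ b * K q 3 ^ c

theorem K_mul_FK : K q 3 * FK q = (q ^ 2)⁻¹ • (FK q * K q 3) := by
  rw [FK, ← mul_assoc, K_mul_F, smul_mul_assoc]

theorem FK_pow_three : FK q ^ 3 = 0 := by
  obtain ⟨c, hc⟩ := mul_pow_eq_smul (K_mul_F q 3) 3
  rw [FK, hc, F_pow, zero_mul, smul_zero]

theorem FK_mul_K_sq : FK q * K q 3 ^ 2 = F q 3 := by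
  rw [FK, mul_assoc, ← pow_succ', K_pow, mul_one]

/-- The scalar `l` stays existential because the correction has degree zero and disappears from
every leading term. -/
theorem exists_FK_mul_E : ∃ l : k, FK q * E q 3 =
    q ^ 2 • (E q 3 * FK q) + l • (1 - K q 3 ^ 2) := by
  refine ⟨q ^ 2 * (q - q⁻¹)⁻¹, ?_⟩
  have h : F q 3 * E q 3 = E q 3 * F q 3 - (q - q⁻¹)⁻¹ • (K q 3 - K q 3 ^ 2) := by
    rw [← E_F]; abel
  have h3 : K q 3 ^ 2 * K q 3 = 1 := by rw [← pow_succ, K_pow]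
  rw [FK, mul_assoc, K_mul_E, mul_smul_comm, ← mul_assoc, h, sub_mul, smul_mul_assoc, sub_mul,
    h3, mul_assoc, ← sq, mul_smul, ← smul_add]
  congr 1
  rw [sub_eq_add_neg, ← smul_neg, neg_sub]

theorem mono_eq_zero_left {a : ℕ} (b c : ℕ) (h : 3 ≤ a) : mono q a b c = 0 := by
  rw [mono, pow_eq_zero_of_le h (E_pow q 3), zero_mul, zero_mul]

theorem mono_eq_zero_right (a : ℕ) {b : ℕ} (c : ℕ) (h : 3 ≤ b) : mono q a b c = 0 := by
  rw [mono, pow_eq_zero_of_le h (FK_pow_three q), mul_zero, zero_mul]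

theorem K_pow_mod (c : ℕ) : K q 3 ^ (c % 3) = K q 3 ^ c := (pow_eq_pow_mod c (K_pow q 3)).symm

end Commutation

/-! ### The degree filtration and leading terms. -/

section Filtration

variable {k : Type*} [Field k] (q : k)

/-- The span of the monomials of degree less than `d` in `E` and `F`. -/
noncomputable def degLT (d : ℕ) : Submodule k (SmallQuantumSL2 q 3) :=
  Submodule.span k {x | ∃ a b c, a + b < d ∧ mono q a b c = x}

variable {q}

theorem mono_mem {a b d : ℕ} (c : ℕ) (h : a + b < d) : mono q a b c ∈ degLT q d :=
  Submodule.subset_span ⟨a, b, c, h, rfl⟩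

theorem degLT_mono {d e : ℕ} (h : d ≤ e) : degLT q d ≤ degLT q e :=
  Submodule.span_mono fun _ ⟨a, b, c, h1, h2⟩ => ⟨a, b, c, by omega, h2⟩

theorem map_mem_degLT {d e : ℕ} (f : SmallQuantumSL2 q 3 →ₗ[k] SmallQuantumSL2 q 3)
    (h : ∀ a b c, a + b < d → f (mono q a b c) ∈ degLT q e) {x : SmallQuantumSL2 q 3}
    (hx : x ∈ degLT q d) : f x ∈ degLT q e := by
  have : degLT q d ≤ (degLT q e).comap f := by
    refine Submodule.span_le.2 ?_
    rintro _ ⟨a, b, c, h1, rfl⟩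
    exact h a b c h1
  exact this hx

theorem mul_K_pow_mem {d : ℕ} (n : ℕ) {x : SmallQuantumSL2 q 3} (hx : x ∈ degLT q d) :
    x * K q 3 ^ n ∈ degLT q d := by
  refine map_mem_degLT (LinearMap.mulRight k (K q 3 ^ n)) (fun a b c h => ?_) hx
  rw [LinearMap.mulRight_apply, mono, mul_assoc, ← pow_add]
  exact mono_mem _ h

theorem mul_FK_pow_mem {d : ℕ} (n : ℕ) {x : SmallQuantumSL2 q 3} (hx : x ∈ degLT q d) :
    x * FK q ^ n ∈ degLT q (d + n) := by
  refine map_mem_degLT (LinearMap.mulRight k (FK q ^ n)) (fun a b c h => ?_) hx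
  rw [LinearMap.mulRight_apply, mono, mul_assoc,
    pow_mul_pow_of_mul_eq_smul (K_mul_FK q), mul_smul_comm, ← mul_assoc, mul_assoc (E q 3 ^ a),
    ← pow_add]
  exact Submodule.smul_mem _ _ (mono_mem _ (by omega))

theorem E_pow_mul_mem {d : ℕ} (n : ℕ) {x : SmallQuantumSL2 q 3} (hx : x ∈ degLT q d) :
    E q 3 ^ n * x ∈ degLT q (d + n) := by
  refine map_mem_degLT (LinearMap.mulLeft k (E q 3 ^ n)) (fun a b c h => ?_) hx
  rw [LinearMap.mulLeft_apply, mono, ← mul_assoc, ← mul_assoc, ← pow_add]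
  exact mono_mem _ (by omega)

theorem K_pow_mul_mono (n a b c : ℕ) : K q 3 ^ n * mono q a b c =
    ((q ^ 2) ^ (n * a) * (q ^ 2)⁻¹ ^ (n * b)) • mono q a b (n + c) := by
  rw [mono, ← mul_assoc, ← mul_assoc, pow_mul_pow_of_mul_eq_smul (K_mul_E q 3), smul_mul_assoc,
    smul_mul_assoc, mul_assoc (E q 3 ^ a), pow_mul_pow_of_mul_eq_smul (K_mul_FK q), mul_smul_comm,
    smul_mul_assoc, smul_smul, ← mul_assoc (E q 3 ^ a), mul_assoc _ (K q 3 ^ n), ← pow_add, mono]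

theorem K_pow_mul_mem {d : ℕ} (n : ℕ) {x : SmallQuantumSL2 q 3} (hx : x ∈ degLT q d) :
    K q 3 ^ n * x ∈ degLT q d := by
  refine map_mem_degLT (LinearMap.mulLeft k (K q 3 ^ n)) (fun a b c h => ?_) hx
  rw [LinearMap.mulLeft_apply, K_pow_mul_mono]
  exact Submodule.smul_mem _ _ (mono_mem _ h)

/-- `F * K` commutes with `E ^ a` up to a scalar and terms of lower degree. -/
theorem FK_mul_E_pow (a : ℕ) :
    FK q * E q 3 ^ a - (q ^ 2) ^ a • (E q 3 ^ a * FK q) ∈ degLT q a := by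
  obtain ⟨l, hl⟩ := exists_FK_mul_E q
  induction a with
  | zero => simp
  | succ a ih =>
    have h2 := K_pow_mul_mono (q := q) 2 a 0 0
    -- Only the first `E` is crossed. The correction is a multiple of (1 − K²)E^a, of degree a
    -- because K² passes E^a up to a scalar; the rest is the inductive error multiplied by `E`.
    have h1 : FK q * E q 3 ^ (a + 1) - (q ^ 2) ^ (a + 1) • (E q 3 ^ (a + 1) * FK q) =
        q ^ 2 • (E q 3 ^ 1 * (FK q * E q 3 ^ a - (q ^ 2) ^ a • (E q 3 ^ a * FK q))) +
          l • (mono q a 0 0 - K q 3 ^ 2 * mono q a 0 0) := by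
      rw [pow_succ' (E q 3), ← mul_assoc, hl, add_mul, smul_mul_assoc, smul_mul_assoc, sub_mul,
        mono, pow_zero, mul_one, pow_zero, mul_one, one_mul, pow_one, mul_sub, mul_smul_comm,
        smul_sub (q ^ 2), smul_smul, ← pow_succ' (q ^ 2), mul_assoc, mul_assoc]
      abel
    rw [h1, h2]
    refine add_mem (Submodule.smul_mem _ _ (E_pow_mul_mem 1 ih)) (Submodule.smul_mem _ _ (sub_mem
      (mono_mem _ (by omega)) (Submodule.smul_mem _ _ (mono_mem _ (by omega)))))

theorem FK_mul_mem {d : ℕ} {x : SmallQuantumSL2 q 3} (hx : x ∈ degLT q d) :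
    FK q * x ∈ degLT q (d + 1) := by
  refine map_mem_degLT (LinearMap.mulLeft k (FK q)) (fun a b c h => ?_) hx
  have h1 : FK q * mono q a b c =
      (FK q * E q 3 ^ a - (q ^ 2) ^ a • (E q 3 ^ a * FK q)) * FK q ^ b * K q 3 ^ c +
        (q ^ 2) ^ a • mono q a (b + 1) c := by
    rw [mono, mono, sub_mul, sub_mul, smul_mul_assoc, smul_mul_assoc, pow_succ' (FK q)]
    simp only [mul_assoc]
    abel
  rw [LinearMap.mulLeft_apply, h1]
  exact add_mem (degLT_mono (by omega) (mul_K_pow_mem c (mul_FK_pow_mem b (FK_mul_E_pow a))))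
    (Submodule.smul_mem _ _ (mono_mem _ (by omega)))

theorem FK_pow_mul_mem {d : ℕ} (n : ℕ) {x : SmallQuantumSL2 q 3} (hx : x ∈ degLT q d) :
    FK q ^ n * x ∈ degLT q (d + n) := by
  induction n with
  | zero => simpa using hx
  | succ n ih =>
    rw [pow_succ', mul_assoc]
    exact FK_mul_mem ih

/-- Each of the b·a crossings costs a factor q² and an error of lower degree, so leading terms
multiply as if `E` and `FK` q-commuted. -/
theorem FK_pow_mul_E_pow (b a : ℕ) :
    FK q ^ b * E q 3 ^ a - (q ^ 2) ^ (b * a) • (E q 3 ^ a * FK q ^ b) ∈ degLT q (a + b) := by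
  induction b with
  | zero => simp
  | succ b ih =>
    have h1 : FK q ^ (b + 1) * E q 3 ^ a -
          (q ^ 2) ^ ((b + 1) * a) • (E q 3 ^ a * FK q ^ (b + 1)) =
        FK q * (FK q ^ b * E q 3 ^ a - (q ^ 2) ^ (b * a) • (E q 3 ^ a * FK q ^ b)) +
          (q ^ 2) ^ (b * a) •
            ((FK q * E q 3 ^ a - (q ^ 2) ^ a • (E q 3 ^ a * FK q)) * FK q ^ b) := by
      rw [pow_succ' (FK q), mul_sub, sub_mul, smul_sub, smul_mul_assoc, smul_smul, mul_smul_comm,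
        ← pow_add, add_mul, one_mul]
      simp only [mul_assoc]
      abel
    rw [h1]
    exact add_mem (FK_mul_mem ih) (Submodule.smul_mem _ _
      (degLT_mono (Nat.le_succ _) (mul_FK_pow_mem b (FK_mul_E_pow a))))

theorem degLT_five : degLT q 5 = ⊤ := by
  -- Degree 5 forces an exponent of at least 3, so the monomial vanishes. Hence the span of degrees
  -- up to 4 is stable under left multiplication by the generators, and it contains 1.
  have h6 : degLT q 6 ≤ degLT q 5 := by
    refine Submodule.span_le.2 ?_
    rintro _ ⟨a, b, c, h1, rfl⟩
    rcases le_or_gt 3 a with ha | ha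
    · rw [mono_eq_zero_left q b c ha]; exact zero_mem _
    rcases le_or_gt 3 b with hb | hb
    · rw [mono_eq_zero_right q a c hb]; exact zero_mem _
    exact mono_mem c (by omega)
  have h : ∀ x : SmallQuantumSL2 q 3, ∀ y ∈ degLT q 5, x * y ∈ degLT q 5 := by
    intro x
    induction x using gen_induction with
    | hE => exact fun y hy => h6 (by simpa using E_pow_mul_mem 1 hy)
    | hF =>
      intro y hy
      rw [← FK_mul_K_sq, mul_assoc]
      exact h6 (FK_mul_mem (K_pow_mul_mem 2 hy))
    | hK => exact fun y hy => by simpa using K_pow_mul_mem 1 hy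
    | hs c => exact fun y hy => by rw [← Algebra.smul_def]; exact Submodule.smul_mem _ _ hy
    | ha x y hx hy => exact fun w hw => by rw [add_mul]; exact add_mem (hx w hw) (hy w hw)
    | hm x y hx hy => exact fun w hw => by rw [mul_assoc]; exact hx _ (hy w hw)
  refine eq_top_iff.2 fun x _ => ?_
  have h1 : (1 : SmallQuantumSL2 q 3) ∈ degLT q 5 := by
    simpa [mono] using mono_mem (q := q) (a := 0) (b := 0) (d := 5) 0 (by omega)
  simpa using h x 1 h1

end Filtration

end SmallQuantumSL2

namespace SmallQuantumSL2

open SmallQuantum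
open scoped TensorProduct

/-! ### Linear independence of the monomials via the regular representation. -/

section RegularModule

variable {k : Type*} [Field k] (q : k)

/-- The action of `E` on coordinates with respect to the basis `mono`. -/
def regE : Module.End k (Fin 3 → Fin 3 → ZMod 3 → k) where
  toFun v := ![0, v 0, v 1]
  map_add' v w := by funext a; fin_cases a <;> simp
  map_smul' r v := by funext a; fin_cases a <;> simp

/-- The action of `K` on coordinates with respect to the basis `mono`. -/
def regK : Module.End k (Fin 3 → Fin 3 → ZMod 3 → k) where
  toFun v a b c := q ^ (2 * a.val + b.val) * v a b (c - 1)
  map_add' v w := by funext a b c; simp [mul_add]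
  map_smul' r v := by funext a b c; simp [mul_left_comm]

/-- The action of `F` on coordinates with respect to the basis `mono`. -/
noncomputable def regF : Module.End k (Fin 3 → Fin 3 → ZMod 3 → k) where
  toFun v a b c := ![0, 1, q ^ 2] b * v a (b - 1) (c + 1) +
    q ^ 2 * (q - q⁻¹)⁻¹ *
      (![(q ^ 2) ^ (b.val + 2), -(q ^ 2) ^ b.val, 0] a * v (a + 1) b (c + 1) +
        ![-(q ^ 2) ^ (2 * b.val + 2), (q ^ 2) ^ (2 * b.val + 1), 0] a * v (a + 1) b (c - 1))
  map_add' v w := by funext a b c; simp; ring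
  map_smul' r v := by funext a b c; simp; ring

theorem regE_apply (v : Fin 3 → Fin 3 → ZMod 3 → k) (a : Fin 3) :
    regE v a = ![0, v 0, v 1] a := rfl

theorem regK_apply (v : Fin 3 → Fin 3 → ZMod 3 → k) (a b : Fin 3) (c : ZMod 3) :
    regK q v a b c = q ^ (2 * a.val + b.val) * v a b (c - 1) := rfl

theorem regF_apply (v : Fin 3 → Fin 3 → ZMod 3 → k) (a b : Fin 3) (c : ZMod 3) :
    regF q v a b c = ![0, 1, q ^ 2] b * v a (b - 1) (c + 1) +
      q ^ 2 * (q - q⁻¹)⁻¹ *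
        (![(q ^ 2) ^ (b.val + 2), -(q ^ 2) ^ b.val, 0] a * v (a + 1) b (c + 1) +
          ![-(q ^ 2) ^ (2 * b.val + 2), (q ^ 2) ^ (2 * b.val + 1), 0] a * v (a + 1) b (c - 1)) :=
  rfl

variable {q}

theorem one_add_add_sq (hq : IsPrimitiveRoot q 3) : 1 + q + q ^ 2 = 0 := by
  have := hq.geom_sum_eq_zero (by norm_num)
  simpa [Finset.sum_range_succ] using this

/-- The operators are left multiplication written in the expected basis; the formula for `regF`
comes from F = FK·K² and the crossing of `FK` past E^a. Indices in `Fin 3` wrap around, and the zero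
entries of its coefficient vectors kill the wrapped terms, as E³ = (FK)³ = 0 requires. -/
theorem isTriple_reg (hq : IsPrimitiveRoot q 3) : IsTriple q 3 regE (regF q) (regK q) := by
  have h1 := one_add_add_sq hq
  have h3 : q ^ 3 = 1 := hq.pow_eq_one
  have h0 : q ≠ 0 := hq.ne_zero (by norm_num)
  have hi : q⁻¹ = q ^ 2 := by field_simp; exact h3.symm
  have hi2 : (q ^ 2)⁻¹ = q := by rw [← hi, inv_inv]
  have c3 : ∀ c : ZMod 3, c - 1 - 1 = c + 1 ∧ c + 1 + 1 = c - 1 := by decide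
  have f1 : (1 : Fin 3) + 1 = 2 := rfl
  have f2 : (0 : Fin 3) - 1 = 2 := rfl
  have f3 : (2 : Fin 3) - 1 = 1 := rfl
  have f4 : (2 : Fin 3) + 1 = 0 := rfl
  -- The relations hold with any scalar in this place, so it becomes a free variable; the `grind`
  -- calls then face polynomial identities modulo 1 + q + q² = 0.
  generalize hl : (q - q⁻¹)⁻¹ = l
  constructor
  · refine LinearMap.ext fun v => ?_
    funext a
    fin_cases a <;> simp [pow_succ, regE_apply]
  · refine LinearMap.ext fun v => ?_
    funext a b c
    rw [pow_succ, sq]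
    simp only [Module.End.mul_apply, LinearMap.zero_apply, Pi.zero_apply, regF_apply, hl]
    fin_cases a <;> fin_cases b <;>
      simp only [Fin.isValue, Fin.zero_eta, Fin.mk_one, Fin.reduceFinMk, Matrix.cons_val, f1, f2, f3, f4, c3,
        zero_mul, mul_zero, add_zero, zero_add, one_mul, sub_add_cancel, add_sub_cancel_right,
        sub_self, Fin.val_zero, Fin.val_one, Fin.val_two]
    all_goals clear hl hi2 hi h0 h3 hq c3 f1 f2 f3 f4; grind
  · refine LinearMap.ext fun v => ?_
    funext a b c
    rw [pow_succ, sq]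
    simp only [Module.End.mul_apply, Module.End.one_apply, regK_apply, c3, add_sub_cancel_right]
    linear_combination (v a b c) * congrArg (· ^ (2 * a.val + b.val)) h3
  · refine LinearMap.ext fun v => ?_
    funext a b c
    fin_cases a <;> simp [regK_apply, regE_apply] <;> ring
  · refine LinearMap.ext fun v => ?_
    funext a b c
    simp only [hi2, Module.End.mul_apply, LinearMap.smul_apply, Pi.smul_apply, smul_eq_mul, regF_apply, regK_apply, hl]
    fin_cases a <;> fin_cases b <;>
      simp only [Fin.isValue, Fin.zero_eta, Fin.mk_one, Fin.reduceFinMk, Matrix.cons_val, f1, f2, f3, f4, c3,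
        zero_mul, mul_zero, add_zero, zero_add, one_mul, sub_add_cancel, add_sub_cancel_right,
        sub_self, Fin.val_zero, Fin.val_one, Fin.val_two]
    all_goals clear hl hi2 hi h0 h3 hq c3 f1 f2 f3 f4; grind
  · refine LinearMap.ext fun v => ?_
    funext a b c
    simp only [Module.End.mul_apply, LinearMap.smul_apply, LinearMap.sub_apply, Pi.sub_apply, Pi.smul_apply, smul_eq_mul, regF_apply, regK_apply, regE_apply, hl, sq (regK q), Nat.reduceSub]
    fin_cases a <;> fin_cases b <;>
      simp only [Fin.isValue, Fin.zero_eta, Fin.mk_one, Fin.reduceFinMk, Matrix.cons_val, f1, f2, f3, f4, c3,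
        zero_mul, mul_zero, add_zero, zero_add, one_mul, sub_self,
        Pi.zero_apply, regF_apply, hl, Fin.val_zero, Fin.val_one, Fin.val_two]
    all_goals clear hl hi2 hi h0 h3 hq c3 f1 f2 f3 f4; grind

/-- The coordinate vector of `mono a b c`. -/
def regBasis (a b : Fin 3) (c : ZMod 3) : Fin 3 → Fin 3 → ZMod 3 → k :=
  fun a' b' c' => if a' = a ∧ b' = b ∧ c' = c then 1 else 0

theorem regK_regBasis (c : ZMod 3) : regK q (regBasis 0 0 c) = regBasis 0 0 (c + 1) := by
  funext a' b' c'
  fin_cases a' <;> fin_cases b' <;> simp [regK_apply, regBasis, sub_eq_iff_eq_add]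

/-- With no power of `E` present the commutator correction in `regF` vanishes. This suffices, since
a monomial is built from 1 by applying K, then `FK`, then `E`. -/
theorem regF_regK_regBasis (hq : IsPrimitiveRoot q 3) (b b' : Fin 3) (h : b.val + 1 = b'.val)
    (c : ZMod 3) : regF q (regK q (regBasis 0 b c)) = regBasis 0 b' c := by
  have h3 : q ^ 2 * q = 1 := by rw [← pow_succ, hq.pow_eq_one]
  funext x y w
  fin_cases b <;> fin_cases b' <;> simp at h <;> fin_cases x <;> fin_cases y <;>
    simp [regK_apply, regF_apply, regBasis, h3]

theorem regE_regBasis (a a' b : Fin 3) (h : a.val + 1 = a'.val) (c : ZMod 3) :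
    regE (regBasis a b c) = (regBasis a' b c : Fin 3 → Fin 3 → ZMod 3 → k) := by
  funext x
  fin_cases a <;> fin_cases a' <;> simp at h <;> fin_cases x <;> funext y w <;>
    simp [regE_apply, regBasis]

/-- The action on the regular module, evaluated at the coordinate vector of `1`. -/
noncomputable def regEval (hq : IsPrimitiveRoot q 3) :
    SmallQuantumSL2 q 3 →ₗ[k] (Fin 3 → Fin 3 → ZMod 3 → k) :=
  LinearMap.applyₗ (regBasis 0 0 0) ∘ₗ (lift _ _ _ (isTriple_reg hq)).toLinearMap

theorem regEval_mono (hq : IsPrimitiveRoot q 3) (a b : Fin 3) (c : ℕ) :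
    regEval hq (mono q a b c) = regBasis a b c := by
  have hK : ∀ n : ℕ, (regK q ^ n) (regBasis 0 0 0) = regBasis 0 0 (n : ZMod 3) := by
    intro n
    induction n with
    | zero => simp
    | succ n ih => rw [pow_succ', Module.End.mul_apply, ih, regK_regBasis, Nat.cast_succ]
  have hF : ∀ n : ℕ, ∀ h : n < 3,
      ((regF q * regK q) ^ n) (regBasis 0 0 (c : ZMod 3)) = regBasis 0 ⟨n, h⟩ c := by
    intro n
    induction n with
    | zero => intro h; simp
    | succ n ih =>
      intro h
      rw [pow_succ', Module.End.mul_apply, ih (by omega), Module.End.mul_apply,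
        regF_regK_regBasis hq _ ⟨n + 1, h⟩ rfl]
  have hE : ∀ n : ℕ, ∀ h : n < 3,
      (regE ^ n) (regBasis 0 b (c : ZMod 3) : Fin 3 → Fin 3 → ZMod 3 → k) =
        regBasis ⟨n, h⟩ b c := by
    intro n
    induction n with
    | zero => intro h; simp
    | succ n ih =>
      intro h
      rw [pow_succ', Module.End.mul_apply, ih (by omega), regE_regBasis _ ⟨n + 1, h⟩ _ rfl]
  rw [regEval, LinearMap.comp_apply, LinearMap.applyₗ_apply_apply, AlgHom.toLinearMap_apply, mono, FK,
    map_mul, map_mul, map_pow, map_pow, map_pow, map_mul, lift_E, lift_F, lift_K,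
    Module.End.mul_apply, Module.End.mul_apply, hK, hF b b.2, hE a a.2]

/-- The coordinate functional of `mono a b c`. -/
noncomputable def coordMono (hq : IsPrimitiveRoot q 3) (a b : Fin 3) (c : ZMod 3) :
    SmallQuantumSL2 q 3 →ₗ[k] k :=
  LinearMap.proj c ∘ₗ LinearMap.proj b ∘ₗ LinearMap.proj a ∘ₗ regEval hq

theorem coordMono_mono (hq : IsPrimitiveRoot q 3) (a b a' b' : Fin 3) (c : ZMod 3) (n : ℕ) :
    coordMono hq a b c (mono q a' b' n) = if a = a' ∧ b = b' ∧ c = n then 1 else 0 := by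
  simp only [coordMono, LinearMap.comp_apply, LinearMap.proj_apply, regEval_mono]
  rfl

/-- This lets diagonal matrix entries be computed modulo terms of lower degree. -/
theorem coordMono_of_mem_degLT (hq : IsPrimitiveRoot q 3) (a b : Fin 3) (c : ZMod 3)
    {x : SmallQuantumSL2 q 3} (hx : x ∈ degLT q (a + b)) : coordMono hq a b c x = 0 := by
  have h : degLT q (a + b) ≤ LinearMap.ker (coordMono hq a b c) := by
    refine Submodule.span_le.2 ?_
    rintro _ ⟨a', b', n, h1, rfl⟩
    rw [SetLike.mem_coe, LinearMap.mem_ker]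
    rcases le_or_gt 3 a' with ha | ha
    · rw [mono_eq_zero_left q b' n ha, map_zero]
    rcases le_or_gt 3 b' with hb | hb
    · rw [mono_eq_zero_right q a' n hb, map_zero]
    refine (coordMono_mono hq a b ⟨a', ha⟩ ⟨b', hb⟩ c n).trans (if_neg ?_)
    rintro ⟨rfl, rfl, -⟩
    exact lt_irrefl _ h1
  exact h hx

/-- The basis of the monomials. -/
noncomputable def monoBasis (hq : IsPrimitiveRoot q 3) :
    Module.Basis (Fin 3 × Fin 3 × ZMod 3) k (SmallQuantumSL2 q 3) :=
  Module.Basis.mk (v := fun i => mono q i.1 i.2.1 i.2.2.val)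
    (by
      refine LinearIndependent.of_comp (regEval hq) ?_
      rw [Fintype.linearIndependent_iff]
      intro g hg i
      have h := congrFun (congrFun (congrFun hg i.1) i.2.1) i.2.2
      simp only [Function.comp_apply, regEval_mono, ZMod.natCast_val, ZMod.cast_id', id_eq,
        Finset.sum_apply, Pi.smul_apply, smul_eq_mul, regBasis, Pi.zero_apply] at h
      rw [Finset.sum_eq_single i] at h
      · simpa using h
      · intro j _ hj
        rw [if_neg, mul_zero]
        rintro ⟨h1, h2, h3⟩
        exact hj (Prod.ext h1.symm (Prod.ext h2.symm h3.symm))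
      · simp)
    (by
      rw [← degLT_five (q := q)]
      refine Submodule.span_le.2 ?_
      rintro _ ⟨a, b, c, -, rfl⟩
      rcases le_or_gt 3 a with ha | ha
      · rw [mono_eq_zero_left q b c ha]; exact zero_mem _
      rcases le_or_gt 3 b with hb | hb
      · rw [mono_eq_zero_right q a c hb]; exact zero_mem _
      refine Submodule.subset_span ⟨(⟨a, ha⟩, ⟨b, hb⟩, (c : ZMod 3)), ?_⟩
      simp only [ZMod.val_natCast, mono, K_pow_mod])

theorem trace_eq_sum_coordMono (hq : IsPrimitiveRoot q 3)
    (f : SmallQuantumSL2 q 3 →ₗ[k] SmallQuantumSL2 q 3) :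
    LinearMap.trace k _ f =
      ∑ a : Fin 3, ∑ b : Fin 3, ∑ c : ZMod 3, coordMono hq a b c (f (mono q a b c.val)) := by
  have h : ∀ i : Fin 3 × Fin 3 × ZMod 3,
      (monoBasis hq).coord i = coordMono hq i.1 i.2.1 i.2.2 := by
    intro i
    refine (monoBasis hq).ext fun j => ?_
    rw [Module.Basis.coord_apply, Module.Basis.repr_self, monoBasis, Module.Basis.mk_apply,
      coordMono_mono, Finsupp.single_apply, ZMod.natCast_val, ZMod.cast_id]
    refine if_congr ?_ rfl rfl
    constructor
    · rintro rfl; exact ⟨rfl, rfl, rfl⟩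
    · rintro ⟨h1, h2, h3⟩
      exact Prod.ext h1.symm (Prod.ext h2.symm h3.symm)
  rw [LinearMap.trace_eq_matrix_trace k (monoBasis hq), Matrix.trace, Fintype.sum_prod_type]
  refine Finset.sum_congr rfl fun a _ => ?_
  rw [Fintype.sum_prod_type]
  refine Finset.sum_congr rfl fun b _ => Finset.sum_congr rfl fun c _ => ?_
  rw [Matrix.diag_apply, LinearMap.toMatrix_apply, ← Module.Basis.coord_apply, h, monoBasis,
    Module.Basis.mk_apply]

end RegularModule

end SmallQuantumSL2

namespace SmallQuantumSL2

open SmallQuantum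
open scoped TensorProduct

/-! ### The group algebra of ⟨K⟩ as a commutative coefficient ring. -/

section CyclicGroupAlgebra

variable {k : Type*} [Field k]

/-- The generator of the group algebra of the cyclic group of order three. -/
noncomputable def cycGen (k : Type*) [Field k] : AddMonoidAlgebra k (ZMod 3) :=
  AddMonoidAlgebra.single 1 1

theorem cycGen_pow (n : ℕ) : cycGen k ^ n = AddMonoidAlgebra.single (n : ZMod 3) 1 := by
  rw [cycGen, AddMonoidAlgebra.single_pow, one_pow, nsmul_one]

theorem cycGen_pow_three : cycGen k ^ 3 = 1 := by
  rw [cycGen_pow]; rfl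

theorem cyc_induction {P : AddMonoidAlgebra k (ZMod 3) → Prop} (h0 : P 0)
    (hadd : ∀ x y, P x → P y → P (x + y)) (hpow : ∀ (n : ℕ) (r : k), P (r • cycGen k ^ n))
    (x : AddMonoidAlgebra k (ZMod 3)) : P x := by
  induction x using AddMonoidAlgebra.induction_linear with
  | zero => exact h0
  | add x y hx hy => exact hadd x y hx hy
  | single c r =>
    have h := hpow c.val r
    rwa [cycGen_pow, ZMod.natCast_val, ZMod.cast_id, AddMonoidAlgebra.smul_single, smul_eq_mul,
      mul_one] at h

variable (q : k)

/-- The embedding of the group algebra of the group generated by `K`. -/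
noncomputable def cycMap : AddMonoidAlgebra k (ZMod 3) →ₐ[k] SmallQuantumSL2 q 3 :=
  AddMonoidAlgebra.lift k _ (ZMod 3)
    { toFun := fun c => K q 3 ^ (Multiplicative.toAdd c).val
      map_one' := by simp
      map_mul' := fun a b => by
        rw [toAdd_mul, ZMod.val_add, K_pow_mod, pow_add] }

theorem cycMap_cycGen_pow (n : ℕ) : cycMap q (cycGen k ^ n) = K q 3 ^ n := by
  rw [map_pow, cycGen, cycMap, AddMonoidAlgebra.lift_single]
  simp [ZMod.val_one]

variable {q}

theorem mul_cycMap_mem {d : ℕ} (r : AddMonoidAlgebra k (ZMod 3)) {x : SmallQuantumSL2 q 3}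
    (hx : x ∈ degLT q d) : x * cycMap q r ∈ degLT q d := by
  induction r using cyc_induction with
  | h0 => simp
  | hadd r s hr hs => rw [map_add, mul_add]; exact add_mem hr hs
  | hpow n r =>
    rw [map_smul, cycMap_cycGen_pow, mul_smul_comm]
    exact Submodule.smul_mem _ _ (mul_K_pow_mem n hx)

end CyclicGroupAlgebra

/-! ### Leading terms of Sweedler powers of monomials. -/

section SweedlerPower

variable {k : Type*} [Field k]

/-- Polynomials in `y` describing the Sweedler powers of `x ^ a` for a skew primitive element `x`
with `Δ(x) = x ⊗ 1 + g ⊗ x` and `g * x = z • x * g`. -/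
def skewPow {R : Type*} [CommRing R] [Algebra k R] (z : k) (y : R) : ℕ → ℕ → R
  | 0, a => if a = 0 then 1 else 0
  | m + 1, a => ∑ s ∈ Finset.HasAntidiagonal.antidiagonal a,
      (gaussBinom z a s.1 * z ^ (s.2 * (s.2 - 1))) • (y ^ s.2 * skewPow z y m s.2)

theorem add_pow_eq_antidiagonal {A : Type*} [Ring A] [Algebra k A] (z : k) (a b : A)
    (h : b * a = z • (a * b)) (n : ℕ) :
    (a + b) ^ n = ∑ s ∈ Finset.HasAntidiagonal.antidiagonal n, gaussBinom z n s.1 • (a ^ s.1 * b ^ s.2) := by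
  rw [add_pow_eq_gaussBinom z a b h,
    Finset.Nat.sum_antidiagonal_eq_sum_range_succ (fun i j => gaussBinom z n i • (a ^ i * b ^ j))]

variable (q : k)

theorem sq_mul_inv_sq (hq : IsPrimitiveRoot q 3) : q ^ 2 * (q ^ 2)⁻¹ = 1 :=
  mul_inv_cancel₀ (pow_ne_zero 2 (hq.ne_zero (by norm_num)))

/-- In Δ(x) = x ⊗ 1 + K ⊗ x the two summands q-commute, for x = E with parameter q² and for x = FK
with q⁻², so the q-binomial formula expands each power. -/
theorem comul_mono [hq : Fact (IsPrimitiveRoot q 3)] (a b c : ℕ) :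
    Coalgebra.comul (R := k) (mono q a b c) =
      ∑ s ∈ Finset.HasAntidiagonal.antidiagonal a, ∑ t ∈ Finset.HasAntidiagonal.antidiagonal b,
        (gaussBinom (q ^ 2) a s.1 * gaussBinom (q ^ 2)⁻¹ b t.1) •
          ((E q 3 ^ s.1 * K q 3 ^ s.2 * FK q ^ t.1 * K q 3 ^ (t.2 + c)) ⊗ₜ[k]
            mono q s.2 t.2 c) := by
  have hodd : Odd 3 := by decide
  have hE : comulHom q 3 hodd hq.out (E q 3) ^ a = ∑ s ∈ Finset.HasAntidiagonal.antidiagonal a,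
      gaussBinom (q ^ 2) a s.1 • ((E q 3 ^ s.1 * K q 3 ^ s.2) ⊗ₜ[k] (E q 3 ^ s.2)) := by
    rw [comulHom_E, add_pow_eq_antidiagonal (q ^ 2)]
    · simp [Algebra.TensorProduct.tmul_pow, Algebra.TensorProduct.tmul_mul_tmul]
    · simp [Algebra.TensorProduct.tmul_mul_tmul, K_mul_E, TensorProduct.smul_tmul']
  have hF : comulHom q 3 hodd hq.out (FK q) ^ b = ∑ t ∈ Finset.HasAntidiagonal.antidiagonal b,
      gaussBinom (q ^ 2)⁻¹ b t.1 • ((FK q ^ t.1 * K q 3 ^ t.2) ⊗ₜ[k] (FK q ^ t.2)) := by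
    have h : comulHom q 3 hodd hq.out (FK q) = FK q ⊗ₜ[k] 1 + K q 3 ⊗ₜ[k] FK q := by
      rw [FK, map_mul, comulHom_F, comulHom_K, add_mul, Algebra.TensorProduct.tmul_mul_tmul,
        Algebra.TensorProduct.tmul_mul_tmul, Kinv_mul_K q 3 hodd, one_mul]
    rw [h, add_pow_eq_antidiagonal (q ^ 2)⁻¹]
    · simp [Algebra.TensorProduct.tmul_pow, Algebra.TensorProduct.tmul_mul_tmul]
    · simp [Algebra.TensorProduct.tmul_mul_tmul, K_mul_FK, TensorProduct.smul_tmul']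
  change comulHom q 3 hodd hq.out (mono q a b c) = _
  rw [mono, map_mul, map_mul, map_pow, map_pow, map_pow, hE, hF, comulHom_K,
    Algebra.TensorProduct.tmul_pow, Finset.sum_mul, Finset.sum_mul]
  refine Finset.sum_congr rfl fun s _ => ?_
  rw [Finset.mul_sum, Finset.sum_mul]
  refine Finset.sum_congr rfl fun t _ => ?_
  rw [smul_mul_assoc, mul_smul_comm, smul_smul, smul_mul_assoc,
    Algebra.TensorProduct.tmul_mul_tmul, Algebra.TensorProduct.tmul_mul_tmul, mono, pow_add]
  simp only [mul_assoc]

/-- The right tensor factors of the coproduct are again monomials with the same `c`, so splitting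
off the first factor of the convolution power gives a recursion within monomials. -/
theorem sweedlerPow_succ_mono [hq : Fact (IsPrimitiveRoot q 3)] (m a b c : ℕ) :
    HopfIndicator.sweedlerPow k (SmallQuantumSL2 q 3) (m + 1) (mono q a b c) =
      ∑ s ∈ Finset.HasAntidiagonal.antidiagonal a, ∑ t ∈ Finset.HasAntidiagonal.antidiagonal b,
        (gaussBinom (q ^ 2) a s.1 * gaussBinom (q ^ 2)⁻¹ b t.1) •
          (E q 3 ^ s.1 * K q 3 ^ s.2 * FK q ^ t.1 * K q 3 ^ (t.2 + c) *
            HopfIndicator.sweedlerPow k (SmallQuantumSL2 q 3) m (mono q s.2 t.2 c)) := by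
  rw [HopfIndicator.sweedlerPow, pow_succ']
  change LinearMap.mul' k _ (TensorProduct.map LinearMap.id
    (HopfIndicator.sweedlerPow k (SmallQuantumSL2 q 3) m)
      (Coalgebra.comul (R := k) (mono q a b c))) = _
  rw [comul_mono, map_sum, map_sum]
  refine Finset.sum_congr rfl fun s _ => ?_
  rw [map_sum, map_sum]
  refine Finset.sum_congr rfl fun t _ => ?_
  rw [map_smul, map_smul, TensorProduct.map_tmul, LinearMap.mul'_apply, LinearMap.id_apply]

theorem sweedlerPow_zero_mono [hq : Fact (IsPrimitiveRoot q 3)] (a b c : ℕ) :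
    HopfIndicator.sweedlerPow k (SmallQuantumSL2 q 3) 0 (mono q a b c) =
      if a = 0 ∧ b = 0 then 1 else 0 := by
  have hodd : Odd 3 := by decide
  rw [HopfIndicator.sweedlerPow, pow_zero]
  change algebraMap k _ (counitHom q 3 hodd (mono q a b c)) = _
  have hF : counitHom q 3 hodd (FK q) = 0 := by rw [FK, map_mul, counitHom_F, zero_mul]
  have h : counitHom q 3 hodd (mono q a b c) = 0 ^ a * 0 ^ b * 1 ^ c := by
    rw [mono, map_mul, map_mul, map_pow, map_pow, map_pow, counitHom_E, hF, counitHom_K]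
  rw [h]
  by_cases ha : a = 0 <;> by_cases hb : b = 0 <;> simp [ha, hb]

/-- Multiplying leading terms. -/
theorem mul_sub_mem_degLT (hq : IsPrimitiveRoot q 3) (j i l p n : ℕ)
    (r : AddMonoidAlgebra k (ZMod 3)) {x : SmallQuantumSL2 q 3}
    (hx : x - E q 3 ^ i * FK q ^ p * cycMap q r ∈ degLT q (i + p)) :
    E q 3 ^ j * K q 3 ^ i * FK q ^ l * K q 3 ^ (p + n) * x -
      ((q ^ 2) ^ (i * i + n * i) * (q ^ 2)⁻¹ ^ (p * p + n * p)) •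
        (E q 3 ^ (j + i) * FK q ^ (l + p) * cycMap q (cycGen k ^ (i + p + n) * r)) ∈
      degLT q (j + i + (l + p)) := by
  set z := q ^ 2 with hz
  have hzi : z * z⁻¹ = 1 := sq_mul_inv_sq q hq
  set v := FK q ^ l * E q 3 ^ i - z ^ (l * i) • (E q 3 ^ i * FK q ^ l) with hv
  have hvm : v ∈ degLT q (i + l) := FK_pow_mul_E_pow l i
  have h1 : K q 3 ^ (p + n) * (E q 3 ^ i * FK q ^ p) =
      (z ^ ((p + n) * i) * z⁻¹ ^ ((p + n) * p)) • (E q 3 ^ i * FK q ^ p * K q 3 ^ (p + n)) := by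
    have := K_pow_mul_mono (q := q) (p + n) i p 0
    simpa only [mono, pow_zero, mul_one, add_zero] using this
  have h2 : K q 3 ^ i * (E q 3 ^ i * FK q ^ (l + p)) =
      (z ^ (i * i) * z⁻¹ ^ (i * (l + p))) • (E q 3 ^ i * FK q ^ (l + p) * K q 3 ^ i) := by
    have := K_pow_mul_mono (q := q) i i (l + p) 0
    simpa only [mono, pow_zero, mul_one, add_zero] using this
  have h3 : FK q ^ l * E q 3 ^ i = v + z ^ (l * i) • (E q 3 ^ i * FK q ^ l) := by
    rw [hv, sub_add_cancel]
  -- The mixed exponents i(l + p) cancel: moving K^i past the powers of `FK` undoes the cost of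
  -- moving FK^l and K^p past E^i. This is why the leading coefficient splits into an `E` part and
  -- an `FK` part.
  have hs : z ^ ((p + n) * i) * z⁻¹ ^ ((p + n) * p) * (z ^ (l * i) *
      (z ^ (i * i) * z⁻¹ ^ (i * (l + p)))) = z ^ (i * i + n * i) * z⁻¹ ^ (p * p + n * p) := by
    have h4 : z ^ (i * (l + p)) * z⁻¹ ^ (i * (l + p)) = 1 := by rw [← mul_pow, hzi, one_pow]
    calc _ = z ^ (i * i + n * i) * z⁻¹ ^ (p * p + n * p) *
          (z ^ (i * (l + p)) * z⁻¹ ^ (i * (l + p))) := by ring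
      _ = _ := by rw [h4, mul_one]
  -- There are two sources of error, each of lower degree: the error already in `x`, and the error
  -- `v` of moving FK^l past E^i.
  have key : E q 3 ^ j * K q 3 ^ i * FK q ^ l * K q 3 ^ (p + n) * x -
      (z ^ (i * i + n * i) * z⁻¹ ^ (p * p + n * p)) •
        (E q 3 ^ (j + i) * FK q ^ (l + p) * cycMap q (cycGen k ^ (i + p + n) * r)) =
      E q 3 ^ j * (K q 3 ^ i * (FK q ^ l * (K q 3 ^ (p + n) *
        (x - E q 3 ^ i * FK q ^ p * cycMap q r)))) +
      (z ^ ((p + n) * i) * z⁻¹ ^ ((p + n) * p)) • (E q 3 ^ j * (K q 3 ^ i *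
        (v * FK q ^ p * cycMap q (cycGen k ^ (p + n) * r)))) := by
    have e1 : E q 3 ^ j * K q 3 ^ i * FK q ^ l * K q 3 ^ (p + n) *
        (E q 3 ^ i * FK q ^ p * cycMap q r) =
        (z ^ ((p + n) * i) * z⁻¹ ^ ((p + n) * p)) • (E q 3 ^ j * (K q 3 ^ i *
        (v * FK q ^ p * cycMap q (cycGen k ^ (p + n) * r)))) +
        (z ^ (i * i + n * i) * z⁻¹ ^ (p * p + n * p)) •
        (E q 3 ^ (j + i) * FK q ^ (l + p) * cycMap q (cycGen k ^ (i + p + n) * r)) := by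
      calc _ = E q 3 ^ j * (K q 3 ^ i * (FK q ^ l * (K q 3 ^ (p + n) *
            (E q 3 ^ i * FK q ^ p) * cycMap q r))) := by simp only [mul_assoc]
        _ = (z ^ ((p + n) * i) * z⁻¹ ^ ((p + n) * p)) • (E q 3 ^ j * (K q 3 ^ i *
            (FK q ^ l * E q 3 ^ i * FK q ^ p * cycMap q (cycGen k ^ (p + n) * r)))) := by
          rw [h1, map_mul, cycMap_cycGen_pow]
          simp only [mul_assoc, smul_mul_assoc, mul_smul_comm]
        _ = (z ^ ((p + n) * i) * z⁻¹ ^ ((p + n) * p)) • (E q 3 ^ j * (K q 3 ^ i *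
              (v * FK q ^ p * cycMap q (cycGen k ^ (p + n) * r)))) +
            (z ^ ((p + n) * i) * z⁻¹ ^ ((p + n) * p) * z ^ (l * i)) • (E q 3 ^ j *
              (K q 3 ^ i * (E q 3 ^ i * FK q ^ (l + p)) *
                cycMap q (cycGen k ^ (p + n) * r))) := by
          rw [h3, pow_add (FK q) l p]
          simp only [add_mul, mul_add, mul_assoc, smul_mul_assoc, mul_smul_comm, smul_add,
            smul_smul]
        _ = _ := by
          rw [h2, ← hs, add_assoc i p n, pow_add (cycGen k) i (p + n), mul_assoc (cycGen k ^ i),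
            map_mul _ (cycGen k ^ i), cycMap_cycGen_pow, pow_add (E q 3) j i]
          simp only [mul_assoc, smul_mul_assoc, mul_smul_comm, smul_smul]
    simp only [mul_sub, mul_assoc] at e1 ⊢
    rw [e1]
    abel
  rw [key]
  refine add_mem ?_ (Submodule.smul_mem _ _ ?_)
  · refine degLT_mono ?_ (E_pow_mul_mem j (K_pow_mul_mem i (FK_pow_mul_mem l
      (K_pow_mul_mem (p + n) hx))))
    omega
  · refine degLT_mono ?_ (E_pow_mul_mem j (K_pow_mul_mem i
      (mul_cycMap_mem _ (mul_FK_pow_mem p hvm))))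
    omega

/-- The leading term of the Sweedler powers of a monomial. -/
theorem sweedlerPow_mono_sub_mem [hq : Fact (IsPrimitiveRoot q 3)] (m a b c : ℕ) :
    HopfIndicator.sweedlerPow k (SmallQuantumSL2 q 3) m (mono q a b c) -
      E q 3 ^ a * FK q ^ b * cycMap q (cycGen k ^ (m * c) *
        (skewPow (q ^ 2) ((q ^ 2) ^ (c + 1) • cycGen k) m a *
          skewPow (q ^ 2)⁻¹ ((q ^ 2)⁻¹ ^ (c + 1) • cycGen k) m b)) ∈ degLT q (a + b) := by
  induction m generalizing a b with
  | zero =>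
    rw [sweedlerPow_zero_mono, skewPow, skewPow]
    by_cases ha : a = 0 <;> by_cases hb : b = 0 <;> simp [ha, hb]
  | succ m ih =>
    rw [sweedlerPow_succ_mono, skewPow, skewPow, Finset.sum_mul_sum, Finset.mul_sum, map_sum,
      Finset.mul_sum, ← Finset.sum_sub_distrib]
    refine sum_mem fun s hs => ?_
    rw [Finset.mul_sum, map_sum, Finset.mul_sum, ← Finset.sum_sub_distrib]
    refine sum_mem fun t ht => ?_
    -- The scalar exponent n² + cn splits into the part absorbed by y = z^(c+1)·κ, κ being the group
    -- generator, and the n(n − 1) in `skewPow`; the truncated subtraction is harmless at n = 0.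
    have hn : ∀ n : ℕ, (c + 1) * n + n * (n - 1) = n * n + c * n := by
      intro n
      cases n with
      | zero => simp
      | succ n => rw [Nat.add_sub_cancel]; ring
    have h := mul_sub_mem_degLT q hq.out s.1 s.2 t.1 t.2 c _ (ih s.2 t.2)
    rw [Finset.HasAntidiagonal.mem_antidiagonal.1 hs, Finset.HasAntidiagonal.mem_antidiagonal.1 ht] at h
    convert Submodule.smul_mem _ (gaussBinom (q ^ 2) a s.1 * gaussBinom (q ^ 2)⁻¹ b t.1) h using 1
    rw [smul_sub]
    congr 1
    simp only [← hn, smul_pow, smul_mul_assoc, mul_smul_comm, map_smul, smul_smul]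
    congr 1
    · ring
    · congr 2
      ring

end SweedlerPower

end SmallQuantumSL2

namespace SmallQuantumSL2

open SmallQuantum
open scoped TensorProduct

/-! ### The antipode on leading terms and the trace formula. -/

section Antipode

variable {k : Type*} [Field k]

theorem mul_pow_of_mul_eq_smul {A : Type*} [Ring A] [Algebra k A] {w : k} {x y : A}
    (h : y * x = w • (x * y)) (n : ℕ) : (x * y) ^ n = w ^ (n.choose 2) • (x ^ n * y ^ n) := by
  induction n with
  | zero => simp
  | succ n ih =>
    have h1 := pow_mul_pow_of_mul_eq_smul h n 1
    rw [pow_one, mul_one] at h1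
    rw [pow_succ, ih, smul_mul_assoc, mul_assoc, ← mul_assoc (y ^ n), h1, smul_mul_assoc,
      mul_smul_comm, smul_smul, mul_assoc x, ← pow_succ, ← mul_assoc, ← pow_succ, ← pow_add,
      Nat.choose_succ_succ' n 1, Nat.choose_one_right, add_comm (n.choose 2)]

variable {q : k}

theorem inv_sq_sq (hq : IsPrimitiveRoot q 3) : (q ^ 2)⁻¹ ^ 2 = q ^ 2 := by
  have h : (q ^ 2) ^ 3 = 1 := by rw [← pow_mul, mul_comm, pow_mul, hq.pow_eq_one, one_pow]
  have h0 : q ≠ 0 := hq.ne_zero (by norm_num)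
  rw [inv_pow, inv_eq_iff_eq_inv]
  field_simp
  linear_combination h

/-- The antipode of a monomial, up to terms of lower degree. -/
theorem antipode_mono_sub_mem [hq : Fact (IsPrimitiveRoot q 3)] (a b c : ℕ) :
    HopfAlgebra.antipode k (mono q a b c) -
      ((-1) ^ a * (q ^ 2) ^ (a.choose 2 + 2 * (c + a + b) * a) *
        ((-1) ^ b * (q ^ 2)⁻¹ ^ (b.choose 2 + 2 * (c + a + b) * b))) •
          mono q a b (2 * (c + a + b)) ∈ degLT q (a + b) := by
  have hodd : Odd 3 := by decide
  set z := q ^ 2 with hz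
  have hpow : ∀ (x : SmallQuantumSL2 q 3) (n : ℕ), antipodeLin q 3 hodd hq.out (x ^ n) =
      antipodeLin q 3 hodd hq.out x ^ n := by
    intro x n
    induction n with
    | zero => simp [antipodeLin_one]
    | succ n ih => rw [pow_succ, antipodeLin_mul, ih, ← pow_succ']
  have hKE : E q 3 * K q 3 ^ 2 = z • (K q 3 ^ 2 * E q 3) := E_mul_Kinv q 3 hodd
  have hKF : FK q * K q 3 ^ 2 = z⁻¹ • (K q 3 ^ 2 * FK q) := by
    have h := pow_mul_pow_of_mul_eq_smul (K_mul_FK q) 2 1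
    rw [pow_one, mul_one, inv_sq_sq hq.out] at h
    rw [h, smul_smul, inv_mul_cancel₀ (pow_ne_zero 2 (hq.out.ne_zero (by norm_num))), one_smul]
  have hE : antipodeLin q 3 hodd hq.out (E q 3 ^ a) =
      ((-1) ^ a * z ^ (a.choose 2)) • (K q 3 ^ (2 * a) * E q 3 ^ a) := by
    rw [hpow, antipodeLin_E, Kinv, neg_pow,
      mul_pow_of_mul_eq_smul hKE, pow_mul (K q 3), mul_smul, ← neg_one_smul k (1 : SmallQuantumSL2 q 3),
      smul_pow, one_pow, smul_mul_assoc, one_mul]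
  have hF : antipodeLin q 3 hodd hq.out (FK q ^ b) =
      ((-1) ^ b * z⁻¹ ^ (b.choose 2)) • (K q 3 ^ (2 * b) * FK q ^ b) := by
    have h : antipodeLin q 3 hodd hq.out (FK q) = -(K q 3 ^ 2 * FK q) := by
      rw [FK, antipodeLin_mul, antipodeLin_K, antipodeLin_F, mul_neg]; rfl
    rw [hpow, h, neg_pow, mul_pow_of_mul_eq_smul hKF, pow_mul (K q 3), mul_smul,
      ← neg_one_smul k (1 : SmallQuantumSL2 q 3), smul_pow, one_pow, smul_mul_assoc, one_mul]
  have hFK : FK q ^ b * K q 3 ^ (2 * a) = z⁻¹ ^ (b * a) • (K q 3 ^ (2 * a) * FK q ^ b) := by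
    rw [pow_mul, pow_mul_pow_of_mul_eq_smul hKF]
  -- `S` reverses products, and S(E) = −K²E, S(FK) = −K²·FK, S(K) = K². Collecting the powers of K
  -- on the left gives the exponent 2(c + a + b), which is −(c + a + b) modulo 3.
  have h1 : antipodeLin q 3 hodd hq.out (mono q a b c) =
      ((-1) ^ a * z ^ (a.choose 2) * ((-1) ^ b * z⁻¹ ^ (b.choose 2)) * z⁻¹ ^ (b * a)) •
        (K q 3 ^ (2 * (c + a + b)) * (FK q ^ b * E q 3 ^ a)) := by
    calc antipodeLin q 3 hodd hq.out (mono q a b c)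
        = ((-1) ^ a * z ^ (a.choose 2) * ((-1) ^ b * z⁻¹ ^ (b.choose 2))) •
          (K q 3 ^ (2 * c) * K q 3 ^ (2 * b) * (FK q ^ b * K q 3 ^ (2 * a)) * E q 3 ^ a) := by
          rw [mono, antipodeLin_mul, antipodeLin_mul, hE, hF, hpow, antipodeLin_K, Kinv, ← pow_mul]
          simp only [smul_mul_assoc, mul_smul_comm, smul_smul, mul_assoc]
      _ = _ := by
          rw [hFK]
          simp only [smul_mul_assoc, mul_smul_comm, smul_smul]
          rw [show 2 * (c + a + b) = 2 * c + 2 * b + 2 * a by ring, pow_add _ (2 * c + 2 * b),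
            pow_add _ (2 * c)]
          simp only [mul_assoc]
  have h2 : mono q a b (2 * (c + a + b)) = E q 3 ^ a * FK q ^ b * K q 3 ^ (2 * (c + a + b)) := rfl
  have h3 := K_pow_mul_mono (q := q) (2 * (c + a + b)) a b 0
  have h4 : mono q a b 0 = E q 3 ^ a * FK q ^ b := by rw [mono, pow_zero, mul_one]
  have h5 := FK_pow_mul_E_pow (q := q) b a
  rw [add_zero, h4] at h3
  change antipodeLin q 3 hodd hq.out (mono q a b c) - _ ∈ _
  have hzi : z⁻¹ ^ (b * a) * z ^ (b * a) = 1 := by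
    rw [← mul_pow, mul_comm, sq_mul_inv_sq q hq.out, one_pow]
  have h6 : antipodeLin q 3 hodd hq.out (mono q a b c) -
      ((-1) ^ a * z ^ (a.choose 2 + 2 * (c + a + b) * a) *
        ((-1) ^ b * z⁻¹ ^ (b.choose 2 + 2 * (c + a + b) * b))) • mono q a b (2 * (c + a + b)) =
      ((-1) ^ a * z ^ (a.choose 2) * ((-1) ^ b * z⁻¹ ^ (b.choose 2)) * z⁻¹ ^ (b * a)) •
        (K q 3 ^ (2 * (c + a + b)) *
          (FK q ^ b * E q 3 ^ a - z ^ (b * a) • (E q 3 ^ a * FK q ^ b))) := by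
    rw [mul_sub, smul_sub, ← h1, mul_smul_comm, h3, smul_smul, smul_smul]
    congr 2
    linear_combination (-(-1) ^ a * z ^ (a.choose 2 + 2 * (c + a + b) * a) *
        ((-1) ^ b * z⁻¹ ^ (b.choose 2 + 2 * (c + a + b) * b))) * hzi
  rw [h6]
  exact Submodule.smul_mem _ _ (K_pow_mul_mem _ h5)

/-- Needed so that the error terms of the Sweedler powers stay negligible after `S` is applied. -/
theorem antipode_mem_degLT [hq : Fact (IsPrimitiveRoot q 3)] {d : ℕ} {x : SmallQuantumSL2 q 3}
    (hx : x ∈ degLT q d) : HopfAlgebra.antipode k x ∈ degLT q d := by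
  refine map_mem_degLT (HopfAlgebra.antipode k) (fun a b c h => ?_) hx
  have h1 := degLT_mono h.le (antipode_mono_sub_mem (q := q) a b c)
  have h2 := add_mem h1 (Submodule.smul_mem _ ((-1) ^ a *
    (q ^ 2) ^ (a.choose 2 + 2 * (c + a + b) * a) * ((-1) ^ b * (q ^ 2)⁻¹ ^ (b.choose 2 +
      2 * (c + a + b) * b))) (mono_mem (q := q) (2 * (c + a + b)) h))
  rwa [sub_add_cancel] at h2

/-- The functional extracting the coefficient of `K ^ (-c)`. -/
noncomputable def coeffNeg (k : Type*) [Field k] (c : ZMod 3) :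
    AddMonoidAlgebra k (ZMod 3) →ₗ[k] k where
  toFun r := r.coeff (-c)
  map_add' r s := by simp
  map_smul' a r := by simp

theorem coeffNeg_cycGen_pow (c : ZMod 3) (n : ℕ) :
    coeffNeg k c (cycGen k ^ n) = if (n : ZMod 3) = -c then 1 else 0 := by
  rw [cycGen_pow]
  change (AddMonoidAlgebra.single (n : ZMod 3) (1 : k)).coeff (-c) = _
  rw [AddMonoidAlgebra.coeff_single, Finsupp.single_apply]

theorem pow_val_eq {z : k} (hz : z ^ 3 = 1) (n m : ℕ) (h : (n : ZMod 3) = m) : z ^ n = z ^ m := by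
  rw [pow_eq_pow_mod n hz, pow_eq_pow_mod m hz, (ZMod.natCast_eq_natCast_iff' n m 3).1 h]

/-- To leading order `S` turns K^n into K^(−(n+a+b)), so K^c is reached exactly when a + b + n = −c;
this explains the factor κ^(a+b) and the coefficient at −c. -/
theorem coordMono_antipode [hq : Fact (IsPrimitiveRoot q 3)] (a b : Fin 3) (c : ZMod 3)
    (r : AddMonoidAlgebra k (ZMod 3)) :
    coordMono hq.out a b c
      (HopfAlgebra.antipode k (E q 3 ^ a.val * FK q ^ b.val * cycMap q r)) =
    (-1) ^ a.val * (q ^ 2) ^ (a.val.choose 2 + c.val * a) *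
      ((-1) ^ b.val * (q ^ 2)⁻¹ ^ (b.val.choose 2 + c.val * b)) *
        coeffNeg k c (cycGen k ^ (a.val + b.val) * r) := by
  have hz : (q ^ 2) ^ 3 = 1 := by rw [← pow_mul, mul_comm, pow_mul, hq.out.pow_eq_one, one_pow]
  have hzi : (q ^ 2)⁻¹ ^ 3 = 1 := by rw [inv_pow, hz, inv_one]
  induction r using cyc_induction with
  | h0 => simp
  | hadd r s hr hs => rw [map_add, mul_add, map_add, map_add, hr, hs, mul_add, map_add, mul_add]
  | hpow n r =>
    have h1 := coordMono_of_mem_degLT hq.out a b c (antipode_mono_sub_mem (q := q) a b n)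
    rw [map_sub, sub_eq_zero, map_smul, coordMono_mono, smul_eq_mul, mono] at h1
    rw [map_smul, cycMap_cycGen_pow, mul_smul_comm, map_smul, map_smul, mul_smul_comm, map_smul,
      ← pow_add, coeffNeg_cycGen_pow, h1, smul_eq_mul, smul_eq_mul]
    by_cases h : c = ((2 * (n + a + b) : ℕ) : ZMod 3)
    · have h' : ((a + b + n : ℕ) : ZMod 3) = -c := by
        rw [h]; push_cast
        generalize ((n : ZMod 3)) = x
        generalize (((a : ℕ) : ZMod 3)) = y
        generalize (((b : ℕ) : ZMod 3)) = w
        revert x y w; decide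
      -- Powers of q² depend on exponents modulo 3 only, so the scalar can be written in terms of
      -- `c`, independently of `n`.
      have h2 : ∀ m : ℕ, ((c.val * m : ℕ) : ZMod 3) = ((2 * (n + a + b) * m : ℕ) : ZMod 3) := by
        intro m
        rw [Nat.cast_mul, Nat.cast_mul, ← h, ZMod.natCast_val, ZMod.cast_id]
      rw [if_pos ⟨rfl, rfl, h⟩, if_pos h', pow_add (q ^ 2), pow_add (q ^ 2)⁻¹,
        pow_add (q ^ 2) (a.val.choose 2) (c.val * a), pow_add (q ^ 2)⁻¹ _ (c.val * b),
        pow_val_eq hz _ _ (h2 a), pow_val_eq hzi _ _ (h2 b)]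
      ring
    · have h' : ¬ ((a + b + n : ℕ) : ZMod 3) = -c := by
        intro h0
        apply h
        rw [← neg_eq_iff_eq_neg] at h0
        rw [← h0]; push_cast
        generalize ((n : ZMod 3)) = x
        generalize (((a : ℕ) : ZMod 3)) = y
        generalize (((b : ℕ) : ZMod 3)) = w
        revert x y w; decide
      rw [if_neg (fun h0 => h h0.2.2), if_neg h']
      ring

/-- The alternating sum of the polynomials `skewPow`, weighted as in the trace of the antipode. -/
noncomputable def skewTrace (z : k) (c m : ℕ) : AddMonoidAlgebra k (ZMod 3) :=
  ∑ a : Fin 3, ((-1) ^ a.val * z ^ (a.val.choose 2 + c * a)) •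
    (cycGen k ^ a.val * skewPow z (z ^ (c + 1) • cycGen k) m a)

/-- Only leading terms reach the diagonal, and they factor over a and b, so for fixed `c` the double
sum is a product of two single sums. -/
theorem indicator_succ [hq : Fact (IsPrimitiveRoot q 3)] (m : ℕ) :
    HopfIndicator.indicator k (SmallQuantumSL2 q 3) (m + 1) =
      ∑ c : ZMod 3, coeffNeg k c (cycGen k ^ (m * c.val) *
        (skewTrace (q ^ 2) c.val m * skewTrace (q ^ 2)⁻¹ c.val m)) := by
  have h : ∀ (a b : Fin 3) (c : ZMod 3), coordMono hq.out a b c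
      ((HopfAlgebra.antipode k ∘ₗ HopfIndicator.sweedlerPow k (SmallQuantumSL2 q 3) m)
        (mono q a b c.val)) = coeffNeg k c (cycGen k ^ (m * c.val) *
      (((-1) ^ a.val * (q ^ 2) ^ (a.val.choose 2 + c.val * a)) •
        (cycGen k ^ a.val * skewPow (q ^ 2) ((q ^ 2) ^ (c.val + 1) • cycGen k) m a) *
      ((-1) ^ b.val * (q ^ 2)⁻¹ ^ (b.val.choose 2 + c.val * b)) •
        (cycGen k ^ b.val * skewPow (q ^ 2)⁻¹ ((q ^ 2)⁻¹ ^ (c.val + 1) • cycGen k) m b))) := by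
    intro a b c
    have h1 := coordMono_of_mem_degLT hq.out a b c
      (antipode_mem_degLT (sweedlerPow_mono_sub_mem q m a b c.val))
    rw [map_sub, map_sub, sub_eq_zero, coordMono_antipode] at h1
    rw [LinearMap.comp_apply, h1, ← smul_eq_mul, ← map_smul]
    congr 1
    simp only [smul_mul_assoc, mul_smul_comm, smul_smul]
    rw [mul_comm ((-1) ^ a.val * _ : k)]
    congr 1
    ring
  rw [HopfIndicator.indicator, Nat.add_sub_cancel, trace_eq_sum_coordMono hq.out]
  simp only [h]
  rw [Finset.sum_congr rfl fun a _ => Finset.sum_comm, Finset.sum_comm]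
  refine Finset.sum_congr rfl fun c _ => ?_
  rw [skewTrace, skewTrace, Finset.sum_mul_sum, Finset.mul_sum, map_sum]
  refine Finset.sum_congr rfl fun a _ => ?_
  rw [Finset.mul_sum, map_sum]

end Antipode

end SmallQuantumSL2

namespace SmallQuantumSL2

open SmallQuantum

/-! ### Closed forms of the recursion. -/

section ClosedForm

variable {k R : Type*} [Field k] [CommRing R] [Algebra k R]

theorem skewPow_zero_right (z : k) (y : R) (m : ℕ) : skewPow z y m 0 = 1 := by
  induction m with
  | zero => simp [skewPow]
  | succ m ih => simp [skewPow, ih, gaussBinom_zero_right]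

theorem skewPow_succ_one (z : k) (y : R) (m : ℕ) :
    skewPow z y (m + 1) 1 = 1 + y * skewPow z y m 1 := by
  simp [skewPow, Finset.Nat.antidiagonal_succ, skewPow_zero_right, gaussBinom, add_comm]

theorem skewPow_succ_two (z : k) (y : R) (m : ℕ) :
    skewPow z y (m + 1) 2 = 1 + algebraMap k R (1 + z) * (y * skewPow z y m 1) +
      algebraMap k R (z ^ 2) * (y ^ 2 * skewPow z y m 2) := by
  simp [skewPow, Finset.Nat.antidiagonal_succ, skewPow_zero_right, gaussBinom, Algebra.smul_def]
  ring

variable {z : k} {y : R}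

/-- Three steps of the recursion add a constant, since y³ = z³ = 1. The term coupling the second
sequence to the growing first one is killed by (1 + y + y²)(1 + z + z²) = 0. -/
theorem skewPow_three_mul (hz : 1 + z + z ^ 2 = 0) (hy : y ^ 3 = 1) (t : ℕ) :
    skewPow z y (3 * t) 1 = t * (1 + y + y ^ 2) ∧
      skewPow z y (3 * t) 2 = t * ((1 - algebraMap k R z) * (1 + algebraMap k R z * y)) := by
  have hZ := congrArg (algebraMap k R) hz
  simp only [map_add, map_one, map_pow, map_zero] at hZ
  induction t with
  | zero => simp [skewPow]
  | succ t ih =>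
    rw [show 3 * (t + 1) = 3 * t + 1 + 1 + 1 by ring]
    simp only [skewPow_succ_two, skewPow_succ_one, ih.1, ih.2, map_add, map_one, map_pow,
      Nat.cast_add, Nat.cast_one]
    generalize algebraMap k R z = Z at hZ
    generalize (t : R) = T
    clear ih
    constructor <;> grind

theorem skewPow_two_mod_zero (hz : 1 + z + z ^ 2 = 0) (hy : y ^ 3 = 1) (t : ℕ) :
    skewPow z y (3 * t) 2 = (t * (1 - z)) • 1 + (t * (z - z ^ 2)) • y + (0 : k) • y ^ 2 := by
  rw [(skewPow_three_mul hz hy t).2]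
  simp only [Algebra.smul_def, map_mul, map_sub, map_natCast, map_one, map_pow, map_zero]
  ring

theorem skewPow_two_mod_one (hz : 1 + z + z ^ 2 = 0) (hy : y ^ 3 = 1) (t : ℕ) :
    skewPow z y (3 * t + 1) 2 = (1 + 2 * t : k) • 1 + (-(t * z ^ 2)) • y + (-t : k) • y ^ 2 := by
  have hZ := congrArg (algebraMap k R) hz
  simp only [map_add, map_one, map_pow, map_zero] at hZ
  rw [skewPow_succ_two, (skewPow_three_mul hz hy t).1, (skewPow_three_mul hz hy t).2]
  simp only [Algebra.smul_def, map_mul, map_add, map_neg, map_natCast, map_one, map_pow,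
    map_ofNat]
  generalize algebraMap k R z = Z at hZ
  generalize (t : R) = T
  grind

theorem skewPow_two_mod_two (hz : 1 + z + z ^ 2 = 0) (hy : y ^ 3 = 1) (t : ℕ) :
    skewPow z y (3 * t + 2) 2 = (1 + t : k) • 1 + (-z ^ 2 - 2 * t * z ^ 2) • y +
      (z ^ 2 + t * z ^ 2) • y ^ 2 := by
  have hZ := congrArg (algebraMap k R) hz
  simp only [map_add, map_one, map_pow, map_zero] at hZ
  rw [skewPow_succ_two, skewPow_succ_one, skewPow_two_mod_one hz hy,
    (skewPow_three_mul hz hy t).1]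
  simp only [Algebra.smul_def, map_mul, map_add, map_sub, map_neg, map_natCast, map_one, map_pow,
    map_ofNat]
  generalize algebraMap k R z = Z at hZ
  generalize (t : R) = T
  grind

/-- The weights agree term by term: 1 + z = −z² and z³ = 1 turn the recursion coefficients at a = 2,
namely 1, (1 + z)·z^(c+1) and z²·z^(2c+2), into 1, −z^c and z^(2c+1). -/
theorem skewTrace_eq (hz : 1 + z + z ^ 2 = 0) (c m : ℕ) :
    skewTrace z c m = skewPow z (z ^ (c + 1) • cycGen k) (m + 1) 2 := by
  have hZ := congrArg (algebraMap k (AddMonoidAlgebra k (ZMod 3))) hz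
  simp only [map_add, map_one, map_pow, map_zero] at hZ
  rw [skewPow_succ_two, skewTrace, Fin.sum_univ_three]
  simp only [Fin.val_zero, Fin.val_one, Fin.val_two, skewPow_zero_right, Algebra.smul_def,
    map_mul, map_pow, map_neg, map_one, map_add, pow_add, pow_mul, Nat.choose_self,
    Nat.choose_zero_succ, Nat.choose_succ_self]
  generalize algebraMap k (AddMonoidAlgebra k (ZMod 3)) z = Z at hZ
  generalize (Z ^ c) = W
  grind

theorem coeffNeg_cycGen_pow_mul (c : ZMod 3) (e : ℕ) (f₀ f₁ f₂ g₀ g₁ g₂ u v : k) :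
    coeffNeg k c (cycGen k ^ e *
      ((f₀ • 1 + f₁ • (u • cycGen k) + f₂ • (u • cycGen k) ^ 2) *
        (g₀ • 1 + g₁ • (v • cycGen k) + g₂ • (v • cycGen k) ^ 2))) =
      f₀ * g₀ * (if (e : ZMod 3) = -c then 1 else 0) +
      (f₀ * (g₁ * v) + f₁ * u * g₀) * (if ((e + 1 : ℕ) : ZMod 3) = -c then 1 else 0) +
      (f₀ * (g₂ * v ^ 2) + f₁ * u * (g₁ * v) + f₂ * u ^ 2 * g₀) *
        (if ((e + 2 : ℕ) : ZMod 3) = -c then 1 else 0) +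
      (f₁ * u * (g₂ * v ^ 2) + f₂ * u ^ 2 * (g₁ * v)) *
        (if ((e + 3 : ℕ) : ZMod 3) = -c then 1 else 0) +
      f₂ * u ^ 2 * (g₂ * v ^ 2) * (if ((e + 4 : ℕ) : ZMod 3) = -c then 1 else 0) := by
  simp only [← coeffNeg_cycGen_pow, ← smul_eq_mul, ← map_smul, ← map_add]
  congr 1
  have hs (a : k) (x : AddMonoidAlgebra k (ZMod 3)) : a • x = algebraMap k _ a * x :=
    Algebra.smul_def a x
  simp only [smul_eq_mul, hs, map_mul, map_add, map_pow]
  ring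

end ClosedForm

/-! ### Evaluation of the indicators. -/

section Indicator

variable {k : Type*} [Field k] {q : k}

theorem indicator_eq [hq : Fact (IsPrimitiveRoot q 3)] (n : ℕ) (hn : 1 ≤ n) :
    HopfIndicator.indicator k (SmallQuantumSL2 q 3) n = (n : k) ^ 2 := by
  obtain ⟨m, rfl⟩ := Nat.exists_eq_add_of_le' hn
  have h1 := one_add_add_sq hq.out
  have h3 := hq.out.pow_eq_one
  have h0 : q ≠ 0 := hq.out.ne_zero (by norm_num)
  have hi : (q ^ 2)⁻¹ = q := by field_simp; exact h3.symm
  have hz : 1 + q ^ 2 + (q ^ 2) ^ 2 = 0 := by grind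
  have hy : ∀ c : ℕ, ((q ^ 2) ^ c • cycGen k) ^ 3 = 1 := by
    intro c
    rw [smul_pow, cycGen_pow_three, ← pow_mul, ← pow_mul, show 2 * (c * 3) = 3 * (2 * c) by ring,
      pow_mul, h3, one_pow, one_smul]
  have hw : ∀ c : ℕ, (q ^ c • cycGen k) ^ 3 = 1 := by
    intro c
    rw [smul_pow, cycGen_pow_three, ← pow_mul, mul_comm, pow_mul, h3, one_pow, one_smul]
  -- Since m ≡ n + 2 modulo 3, the exponent can be expressed through n = m + 1 = 3t + r without
  -- subtraction; afterwards only `r` matters.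
  have hκ : ∀ c : ℕ, cycGen k ^ (m * c) = cycGen k ^ ((m + 1 + 2) * c) := by
    intro c
    rw [show (m + 1 + 2) * c = m * c + 3 * c by ring, pow_add, pow_mul _ 3, cycGen_pow_three,
      one_pow, mul_one]
  have hκ3 : ∀ t r c : ℕ, cycGen k ^ ((3 * t + r + 2) * c) = cycGen k ^ ((r + 2) * c) := by
    intro t r c
    rw [show (3 * t + r + 2) * c = 3 * (t * c) + (r + 2) * c by ring, pow_add, pow_mul _ 3,
      cycGen_pow_three, one_pow, one_mul]
  rw [indicator_succ, hi]
  simp only [skewTrace_eq hz, skewTrace_eq h1, hκ]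
  obtain ⟨t, r, hr, ht⟩ : ∃ t r, r < 3 ∧ m + 1 = 3 * t + r :=
    ⟨(m + 1) / 3, (m + 1) % 3, Nat.mod_lt _ (by norm_num), (Nat.div_add_mod _ _).symm⟩
  rw [ht]
  clear ht hκ
  simp only [hκ3]
  have v0 : ZMod.val (0 : ZMod 3) = 0 := rfl
  have v1 : ZMod.val (1 : ZMod 3) = 1 := rfl
  have v2 : ZMod.val (2 : ZMod 3) = 2 := rfl
  have hsum : ∀ f : ZMod 3 → k, ∑ c, f c = f 0 + f 1 + f 2 := fun f => Fin.sum_univ_three f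
  rw [hsum]
  interval_cases r
  · simp only [add_zero, skewPow_two_mod_zero hz (hy _), skewPow_two_mod_zero h1 (hw _),
      coeffNeg_cycGen_pow_mul, v0, v1, v2]
    -- All exponents of the group generator are now numerals, so the coefficient conditions are
    -- decided; an identity in T and q modulo 1 + q + q² = 0 remains.
    simp +decide only [if_true, if_false, mul_zero, mul_one, add_zero, zero_add]
    push_cast
    generalize (t : k) = T
    clear hy hw hκ3 v0 v1 v2 hsum hi h3 h0 hz
    grind
  · simp only [skewPow_two_mod_one hz (hy _), skewPow_two_mod_one h1 (hw _),
      coeffNeg_cycGen_pow_mul, v0, v1, v2]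
    simp +decide only [if_true, if_false, mul_zero, mul_one, add_zero, zero_add]
    push_cast
    generalize (t : k) = T
    clear hy hw hκ3 v0 v1 v2 hsum hi h3 h0 hz
    grind
  · simp only [skewPow_two_mod_two hz (hy _), skewPow_two_mod_two h1 (hw _),
      coeffNeg_cycGen_pow_mul, v0, v1, v2]
    simp +decide only [if_true, if_false, mul_zero, mul_one, add_zero, zero_add]
    push_cast
    generalize (t : k) = T
    clear hy hw hκ3 v0 v1 v2 hsum hi h3 h0 hz
    grind

end Indicator

end SmallQuantumSL2

/-! ### The minimal polynomial of the sequence of squares. -/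

namespace HopfIndicator

open Polynomial

variable {k : Type*} [Field k]

theorem shiftEval_sub_one_mul (v : ℕ → k) (j : ℕ) (p : k[X]) :
    shiftEval v j ((X - 1) * p) = shiftEval v (j + 1) p - shiftEval v j p := by
  have h : (X - 1 : k[X]) * p = monomial 1 1 * p + monomial 0 (-1) * p := by
    rw [← add_mul]
    congr 1
    rw [← C_mul_X_pow_eq_monomial, ← C_mul_X_pow_eq_monomial]
    simp [sub_eq_add_neg]
  rw [h, shiftEval_add, shiftEval_monomial_mul, shiftEval_monomial_mul]
  simp [sub_eq_add_neg]

theorem shiftEval_one (v : ℕ → k) (j : ℕ) : shiftEval v j 1 = v j := by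
  have := shiftEval_monomial v j 0 1
  simpa using this

/-- The minimal polynomial of a sequence of squares. -/
theorem seqMinpoly_sq [CharZero k] (v : ℕ → k) (hv : ∀ n : ℕ, 1 ≤ n → v n = (n : k) ^ 2) :
    seqMinpoly v = (X - 1) ^ 3 := by
  set g := Submodule.IsPrincipal.generator (recurrenceIdeal v) with hg
  have hmem : ∀ p, p ∈ recurrenceIdeal v ↔ g ∣ p := fun p => by
    rw [← Ideal.mem_span_singleton, hg, Ideal.span_singleton_generator]
  have hmonic : ∀ i : ℕ, ((X - 1 : k[X]) ^ i).Monic := fun i => by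
    rw [← C_1]; exact (monic_X_sub_C 1).pow i
  have h3 : (X - 1 : k[X]) ^ 3 ∈ recurrenceIdeal v := by
    intro j hj
    rw [pow_succ', pow_succ', pow_one]
    -- The trailing factor 1 lets the difference rule apply to the last X − 1 as well.
    nth_rewrite 3 [← mul_one (X - 1)]
    simp only [shiftEval_sub_one_mul, shiftEval_one]
    rw [hv _ hj, hv _ (by omega), hv _ (by omega), hv _ (by omega)]
    push_cast
    ring
  -- The second difference of the squares is 2, nonzero in characteristic zero; testing at j = 1 is
  -- enough.
  have h2 : (X - 1 : k[X]) ^ 2 ∉ recurrenceIdeal v := by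
    intro h
    have h := h 1 le_rfl
    rw [sq] at h
    nth_rewrite 2 [← mul_one (X - 1)] at h
    simp only [shiftEval_sub_one_mul, shiftEval_one] at h
    rw [hv _ le_rfl, hv _ (by omega), hv _ (by omega)] at h
    norm_num at h
  have hprime : Prime (X - 1 : k[X]) := by rw [← C_1]; exact prime_X_sub_C 1
  -- As X − 1 is prime, the generator is associated to some (X − 1)^i with i ≤ 3, and i ≤ 2 would
  -- put (X − 1)² in the ideal.
  obtain ⟨i, hi, hassoc⟩ := (dvd_prime_pow hprime 3).1 ((hmem _).1 h3)
  have hi3 : i = 3 := by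
    by_contra hne
    exact h2 ((hmem _).2 (hassoc.dvd.trans (pow_dvd_pow _ (by omega))))
  subst hi3
  have hg0 : g ≠ 0 := by
    rintro h0
    rw [h0] at hassoc
    exact (hmonic 3).ne_zero (hassoc.symm.eq_zero_iff.2 rfl)
  exact eq_of_monic_of_associated (monic_mul_leadingCoeff_inv hg0) (hmonic 3)
    ((associated_mul_unit_left _ _ (by
      rw [isUnit_C]; exact (inv_ne_zero (leadingCoeff_ne_zero.2 hg0)).isUnit)).trans hassoc)

end HopfIndicator

theorem mainTheorem11 {k : Type*} [Field k] [IsAlgClosed k] [CharZero k]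
    (q : k) [Fact (IsPrimitiveRoot q 3)] :
    (∀ n : ℕ, 1 ≤ n → HopfIndicator.indicator k (SmallQuantumSL2 q 3) n = (n : k) ^ 2) ∧
      HopfIndicator.indicatorMinpoly k (SmallQuantumSL2 q 3) =
        (Polynomial.X - 1 : Polynomial k) ^ 3 :=
  ⟨SmallQuantumSL2.indicator_eq, HopfIndicator.seqMinpoly_sq _ SmallQuantumSL2.indicator_eq⟩
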